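/- Let $\mathbb K$ be a field, $x\in\mathbb K$, $k\ge 1$ and $0\le r\le k$. Let $u_0=1$, $u_1(y)=y$, $u_j(y)=y\,u_{j-1}(y)-u_{j-2}(y)$ be the rescaled Chebyshev polynomials of the second kind, so that $u_{-1}=0$. If $r\le k-2$, assume $u_j(x-1)\neq 0$ for $1\le j\le r$. **Paths and the bilinear form.** For $m\ge 0$ and $i\in\mathbb Z$ let $\mathcal P_m^{i}$ be the set of Motzkin paths of length $m$ and rank $i$: the sequences $p=(a_1,\dots,a_m)$ in $\{-1,0,1\}$ with all partial sums $\ge 0$ and total sum $i$ (this set is empty if $i<0$ or $i>m$). Order $\mathcal P_m^{i}$ by: $p<q$ if, at the last position where they differ, the entry of $p$ is larger. An entry $a_s=1$ is paired with $a_t=-1$ if $t$ is the smallest index $>s$ with $a_s+\dots+a_t=0$. Paired positions are joined by an edge, an unpaired entry $1$ is a white vertex, and all other vertices are black; thus $p$ is identified with a planar 1-factor having $i$ white vertices. For $p,q\in\mathcal P_m^{i}$ let $d_p^q$ be the Motzkin diagram on two rows of $m$ vertices with the edges of $q$ in the top row, the edges of $p$ in the bottom row, and the white vertices of $q$ joined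 to those of $p$ in the unique planar way. The product of two diagrams is obtained by stacking the first above the second, identifying the two middle rows, and replacing each closed loop in the middle row by a factor $x$. The rank of a diagram is its number of edges joining the two rows. Let $\mathsf C_m^{(i)}$ be the $\mathbb K$-vector space with basis $\mathcal P_m^{i}$, with the bilinear form determined by $d_p^p d_q^q\equiv\langle p,q\rangle\, d_q^p$ modulo the span of the diagrams of rank $<i$. That is, $\langle p,q\rangle=0$ if the diagram of the product $d_p^pd_q^q$ has rank $<i$, and otherwise $\langle p,q\rangle=x^{\kappa(p,q)}$, where $\kappa(p,q)$ is the number of closed loops in the middle row. Let $\mathsf G_m^{(i)}=(\langle p,q\rangle)_{p,q\in\mathcal P_m^{i}}$; it is the empty matrix if $i<0$ or $i>m$. **The modified basis.** Let $\mathcal P_k^{r,\ell}$ be the set of $p\in\mathcal P_k^r$ whose last entry is $\ell$. If $p\in\mathcal P_k^{r,-1}$, its pivot edge is the edge at vertex $k$. For a 1-factor $p$ with a pivot edge joining $i<j$, let $p_\bullet$ be obtained by deleting the pivot edge (its ends become isolated black vertices). Let $p^{(1)}$ be obtained by removing the pivot edge, joining $i$ to the rightmost white vertex $h<i$ by a new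 edge, which is the pivot edge of $p^{(1)}$, and making $j$ white; if there is no white vertex to the left of $i$, then $p^{(1)}=0$. Put $p^{(0)}=p$, $p^{(t+1)}=(p^{(t)})^{(1)}$, $[0]=0$, and for $p\in\mathcal P_k^{r,-1}$ define recursively, for $0\le t\le r$, $$[p^{(t)}]=p^{(t)}-\big(p^{(t)}\big)_\bullet-\frac{u_{r-t-1}(x-1)}{u_{r-t}(x-1)}\,[p^{(t+1)}].$$ **Theorem.** The family consisting of $\mathcal P_k^{r,1}$, $\mathcal P_k^{r,0}$ and the $[p]$ with $p\in\mathcal P_k^{r,-1}$ is a basis of $\mathsf C_k^{(r)}$. Ordered by the order of the paths $p\in\mathcal P_k^{r}$ to which its members correspond, it gives the form on $\mathsf C_k^{(r)}$ the block-diagonal Gram matrix $$\begin{pmatrix}\mathsf G_{k-1}^{(r-1)}&0&0\\0&\mathsf G_{k-1}^{(r)}&0\\0&0&\dfrac{u_{r+1}(x-1)}{u_r(x-1)}\,\mathsf G_{k-1}^{(r+1)}\end{pmatrix}.$$ Here the three blocks are indexed by $\mathcal P_k^{r,1}$, $\mathcal P_k^{r,0}$ and $\mathcal P_k^{r,-1}$,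 in this order, and these sets are identified with $\mathcal P_{k-1}^{r-1}$, $\mathcal P_{k-1}^{r}$ and $\mathcal P_{k-1}^{r+1}$ by the order-preserving bijections that delete the last entry. If $r\geq k-1$, the third block is empty. -/

import Mathlib

namespace Motzkin

/-! ### Motzkin paths and 1-factors -/

/-- Sequences `(a_1, …, a_k)` with entries in `{-1, 0, 1}` (indexed from `0`). -/
abbrev Steps (k : ℕ) : Type := Fin k → SignType

/-- `a` is a Motzkin path of rank `r`: its partial sums are nonnegative and its sum is `r`. -/
def IsPath {k : ℕ} (r : ℤ) (a : Steps k) : Prop :=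
  (∀ s : Fin k, 0 ≤ ∑ i ∈ Finset.Iic s, (a i : ℤ)) ∧ ∑ i, (a i : ℤ) = r

instance {k : ℕ} (r : ℤ) : DecidablePred (IsPath (k := k) r) :=
  fun _ => inferInstanceAs (Decidable (_ ∧ _))

/-- The set of Motzkin paths of length `k` and rank `r`; it is empty when `r < 0` or `k < r`. -/
abbrev Path (k : ℕ) (r : ℤ) : Type := {a : Steps k // IsPath r a}

/-- The total order on paths: `p < q` iff, at the last place where they differ, the entry of `p`
is the larger one. -/
def PathLT (k : ℕ) (r : ℤ) (p q : Path k r) : Prop :=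
  ∃ i, q.1 i < p.1 i ∧ ∀ j, i < j → p.1 j = q.1 j

/-- The entries `a i = 1` and `a j = -1` are paired: `j` is the smallest index `> i` with
`a i + ⋯ + a j = 0`. These are the edges of the 1-factor of `a`. -/
def Paired {k : ℕ} (a : Steps k) (i j : Fin k) : Prop :=
  i < j ∧ a i = 1 ∧ ∑ l ∈ Finset.Icc i j, (a l : ℤ) = 0 ∧
    ∀ m, i < m → m < j → ∑ l ∈ Finset.Icc i m, (a l : ℤ) ≠ 0

/-- The white vertices of the 1-factor of `a`: the unpaired entries `1`. -/
def White {k : ℕ} (a : Steps k) (i : Fin k) : Prop :=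
  a i = 1 ∧ ∀ j, ¬ Paired a i j

/-! ### Diagrams, their products, and the bilinear form -/

/-- A diagram on two rows of `k` vertices, as a graph: `Sum.inl` is the top row and `Sum.inr` is
the bottom row. -/
abbrev Diagram (k : ℕ) : Type := SimpleGraph (Fin k ⊕ Fin k)

/-- The Motzkin diagram with bottom row `p` and top row `q`: the horizontal edges are those of the
1-factors, and the `n`-th white vertex of `q` is joined to the `n`-th white vertex of `p`. -/
def diagram {k : ℕ} (p q : Steps k) : Diagram k :=
  SimpleGraph.fromRel fun v w =>
    match v, w with
    | Sum.inl i, Sum.inl j => Paired q i j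
    | Sum.inr i, Sum.inr j => Paired p i j
    | Sum.inl i, Sum.inr j =>
        White q i ∧ White p j ∧
          {l | l < i ∧ White q l}.ncard = {l | l < j ∧ White p l}.ncard
    | Sum.inr _, Sum.inl _ => False

/-- The diagram `d₁` placed on the top and middle rows of three rows (top, middle, bottom). -/
def upper {k : ℕ} (d₁ : Diagram k) : SimpleGraph (Fin k ⊕ (Fin k ⊕ Fin k)) :=
  d₁.map (Sum.map id Sum.inl)

/-- The diagram `d₂` placed on the middle and bottom rows of three rows. -/
def lower {k : ℕ} (d₂ : Diagram k) : SimpleGraph (Fin k ⊕ (Fin k ⊕ Fin k)) :=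
  d₂.map Sum.inr

/-- The stack of `d₁` above `d₂`, the bottom row of `d₁` being identified with the top row
of `d₂`. -/
def stack {k : ℕ} (d₁ d₂ : Diagram k) : SimpleGraph (Fin k ⊕ (Fin k ⊕ Fin k)) :=
  upper d₁ ⊔ lower d₂

/-- The diagram underlying the product `d₁ d₂`: two distinct vertices of the outer rows are joined
iff the stack contains a path between them. -/
def comp {k : ℕ} (d₁ d₂ : Diagram k) : Diagram k where
  Adj v w := v ≠ w ∧ (stack d₁ d₂).Reachable (Sum.map id Sum.inr v) (Sum.map id Sum.inr w)
  symm := ⟨fun _ _ h => ⟨h.1.symm, h.2.symm⟩⟩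
  loopless := ⟨fun _ h => h.1 rfl⟩

/-- The rank of a diagram: the number of its vertical edges. -/
noncomputable def rank {k : ℕ} (d : Diagram k) : ℕ :=
  {e : Fin k × Fin k | d.Adj (Sum.inl e.1) (Sum.inr e.2)}.ncard

/-- The number of closed loops in the middle row of the stack of `d₁` above `d₂`: the components
in which every vertex is an endpoint both of an edge of `d₁` and of an edge of `d₂`. -/
noncomputable def loops {k : ℕ} (d₁ d₂ : Diagram k) : ℕ :=
  {c : (stack d₁ d₂).ConnectedComponent |
    ∀ v ∈ c.supp, (∃ w, (upper d₁).Adj v w) ∧ ∃ w, (lower d₂).Adj v w}.ncard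

/-- The cell module: the free module on the Motzkin paths of length `k` and rank `r`. -/
abbrev CellModule (K : Type*) [Field K] (k : ℕ) (r : ℤ) : Type _ := Path k r →₀ K

/-- The Gram matrix in the basis of Motzkin paths. Its entry `⟨p, q⟩` is the scalar with
`d_p^p d_q^q ≡ ⟨p, q⟩ d_q^p` modulo the span of the diagrams of rank `< r`: it is `0` if the product
has rank `< r`, and otherwise `x ^ κ`, with `κ` the number of loops removed from the middle row. -/
noncomputable def gram {K : Type*} [Field K] (x : K) (k : ℕ) (r : ℤ) :
    Matrix (Path k r) (Path k r) K :=
  Matrix.of fun p q =>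
    if (rank (comp (diagram p.1 p.1) (diagram q.1 q.1)) : ℤ) < r then 0
    else x ^ loops (diagram p.1 p.1) (diagram q.1 q.1)

/-- The bilinear form `⟨·, ·⟩` of the cell module. -/
noncomputable def cellForm {K : Type*} [Field K] (x : K) (k : ℕ) (r : ℤ) :
    LinearMap.BilinForm K (CellModule K k r) :=
  Matrix.toBilin Finsupp.basisSingleOne (gram x k r)

/-! ### Moving the pivot edge -/

theorem sum_Icc_succ {k : ℕ} (a : Steps k) {i s t : Fin k} (his : i ≤ s)
    (hst : (t : ℕ) = s + 1) :
    ∑ l ∈ Finset.Icc i t, (a l : ℤ) = ∑ l ∈ Finset.Icc i s, (a l : ℤ) + (a t : ℤ) := by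
  have h : Finset.Icc i t = insert t (Finset.Icc i s) := by
    ext l
    simp only [Finset.mem_Icc, Finset.mem_insert, Fin.le_def, Fin.ext_iff] at *
    omega
  rw [h, Finset.sum_insert, add_comm]
  simp only [Finset.mem_Icc, Fin.le_def]
  omega

theorem neg_one_le (σ : SignType) : (-1 : ℤ) ≤ (σ : ℤ) := by
  cases σ <;> simp

theorem sum_pos_of_ne {k : ℕ} {a : Steps k} {i : Fin k} (hi : a i = 1) (n : ℕ) :
    ∀ s : Fin k, (s : ℕ) = i + n →
      (∀ m, i < m → m ≤ s → ∑ l ∈ Finset.Icc i m, (a l : ℤ) ≠ 0) →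
      0 < ∑ l ∈ Finset.Icc i s, (a l : ℤ) := by
  induction n with
  | zero =>
    intro s hs _
    obtain rfl : s = i := Fin.ext (by simpa using hs)
    simp [hi]
  | succ n ih =>
    intro s hs h
    have hlt : (i : ℕ) + n < k := by have := s.2; omega
    have h1 := ih ⟨i + n, hlt⟩ rfl (fun m hm hm' => h m hm (by
      simp only [Fin.le_def] at *; omega))
    have h2 := sum_Icc_succ a (i := i) (s := ⟨i + n, hlt⟩) (t := s)
      (by simp [Fin.le_def]) (by simp [hs]; omega)
    have h3 := h s (by simp only [Fin.lt_def]; omega) le_rfl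
    have h4 := neg_one_le (a s)
    omega

theorem Paired.sum_pos {k : ℕ} {a : Steps k} {i j : Fin k} (h : Paired a i j) {s : Fin k}
    (his : i ≤ s) (hsj : s < j) : 0 < ∑ l ∈ Finset.Icc i s, (a l : ℤ) :=
  sum_pos_of_ne h.2.1 (s - i) s (by simp only [Fin.le_def] at his; omega)
    fun m hm hms => h.2.2.2 m hm (lt_of_le_of_lt hms hsj)

theorem White.sum_pos {k : ℕ} {a : Steps k} {i : Fin k} (h : White a i) {s : Fin k}
    (his : i ≤ s) : 0 < ∑ l ∈ Finset.Icc i s, (a l : ℤ) := by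
  refine sum_pos_of_ne h.1 (s - i) s (by simp only [Fin.le_def] at his; omega) ?_
  intro m
  induction m using WellFoundedLT.induction with
  | _ m ih =>
    intro hm hms h0
    exact h.2 m ⟨hm, h.1, h0, fun t ht htm => ih t htm ht (htm.le.trans hms)⟩

theorem Paired.right_eq {k : ℕ} {a : Steps k} {i j : Fin k} (h : Paired a i j) : a j = -1 := by
  have hij := h.1
  simp only [Fin.lt_def] at hij
  have hlt : (j : ℕ) - 1 < k := by have := j.2; omega
  have h1 := h.sum_pos (s := ⟨j - 1, hlt⟩) (by simp only [Fin.le_def]; omega)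
    (by simp only [Fin.lt_def]; omega)
  have h2 := sum_Icc_succ a (i := i) (s := ⟨j - 1, hlt⟩) (t := j)
    (by simp only [Fin.le_def]; omega) (by simp only; omega)
  rw [h.2.2.1] at h2
  cases hj : a j
  · simp [hj] at h2; omega
  · rfl
  · simp [hj] at h2; omega

/-- In a path of nonnegative rank that ends in `-1`, the last vertex is paired. -/
theorem exists_paired_last {n : ℕ} {r : ℕ} (p : Path (n + 1) r) (h : p.1 (Fin.last n) = -1) :
    ∃ i, Paired p.1 i (Fin.last n) := by
  obtain ⟨a, ha⟩ := p
  dsimp only at h ⊢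
  let T : Fin (n + 1) → ℤ := fun i => ∑ l ∈ Finset.Icc i (Fin.last n), (a l : ℤ)
  have hlast : T (Fin.last n) = -1 := by simp [T, h]
  have hsplit : ∀ i s t : Fin (n + 1), i ≤ s → (t : ℕ) = s + 1 →
      T i = ∑ l ∈ Finset.Icc i s, (a l : ℤ) + T t := by
    intro i s t his hst
    have hu : Finset.Icc i (Fin.last n) = Finset.Icc i s ∪ Finset.Icc t (Fin.last n) := by
      ext l
      simp only [Finset.mem_Icc, Finset.mem_union, Fin.le_def, Fin.val_last] at *
      omega
    have hd : Disjoint (Finset.Icc i s) (Finset.Icc t (Fin.last n)) := by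
      rw [Finset.disjoint_left]
      intro l h1 h2
      simp only [Finset.mem_Icc, Fin.le_def] at *
      omega
    simp only [T]
    rw [hu, Finset.sum_union hd]
  have h0 : 0 ≤ T 0 := by
    have : Finset.Icc 0 (Fin.last n) = Finset.univ := by
      ext l; simp [Fin.le_last]
    simp only [T, this, ha.2]
    exact Int.natCast_nonneg r
  let S : Finset (Fin (n + 1)) := Finset.univ.filter fun i => 0 ≤ T i
  have hS : S.Nonempty := ⟨0, by simp [S, h0]⟩
  obtain ⟨i, hiS, hmax⟩ := S.exists_max_image id hS
  have hi : 0 ≤ T i := by simpa [S] using hiS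
  have hneg : ∀ t, i < t → T t < 0 := by
    intro t ht
    by_contra hcon
    exact absurd (hmax t (by simpa [S] using hcon)) (not_le.mpr ht)
  have hil : i < Fin.last n := by
    refine lt_of_le_of_ne (Fin.le_last i) ?_
    rintro rfl
    omega
  have hil' : (i : ℕ) < n := by simpa [Fin.lt_def] using hil
  have h1 := hsplit i i ⟨i + 1, by omega⟩ le_rfl rfl
  have h2 := hneg ⟨i + 1, by omega⟩ (by simp [Fin.lt_def])
  simp only [Finset.Icc_self, Finset.sum_singleton] at h1
  have hai : a i = 1 := by
    cases hc : a i
    · simp [hc] at h1; omega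
    · simp [hc] at h1; omega
    · rfl
  have hTi : T i = 0 := by simp [hai] at h1; omega
  refine ⟨i, hil, hai, hTi, ?_⟩
  intro m him hml
  have hm : (m : ℕ) < n := by simpa [Fin.lt_def] using hml
  have h3 := hsplit i m ⟨m + 1, by omega⟩ him.le rfl
  have h4 := hneg ⟨m + 1, by omega⟩ (by simp only [Fin.lt_def] at *; omega)
  omega

/-- A path with a marked pivot edge, joining the vertex `left` to the vertex `right`. The conditions
recorded here hold for every edge of the 1-factor; they ensure that moving the pivot edge yields
paths of the same rank. -/
structure PivotPath (k : ℕ) (r : ℤ) where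
  path : Path k r
  left : Fin k
  right : Fin k
  lt : left < right
  left_eq : path.1 left = 1
  right_eq : path.1 right = -1
  sum_pos : ∀ s, left ≤ s → s < right → 0 < ∑ l ∈ Finset.Icc left s, (path.1 l : ℤ)

namespace PivotPath

/-- Replacing the entries at the ends of the pivot edge. -/
def replace {k : ℕ} {r : ℤ} (P : PivotPath k r) (σ τ : SignType) : Steps k :=
  Function.update (Function.update P.path.1 P.left σ) P.right τ

theorem replace_apply {k : ℕ} {r : ℤ} (P : PivotPath k r) (σ τ : SignType) (i : Fin k) :
    (P.replace σ τ i : ℤ) = (P.path.1 i : ℤ) + (if i = P.left then (σ : ℤ) - 1 else 0)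
      + (if i = P.right then (τ : ℤ) + 1 else 0) := by
  have hne : P.left ≠ P.right := P.lt.ne
  unfold replace
  by_cases h1 : i = P.right
  · subst h1
    simp [P.right_eq, hne.symm]
  · by_cases h2 : i = P.left
    · subst h2
      simp [P.left_eq, hne]
    · simp [h1, h2]

theorem sum_replace {k : ℕ} {r : ℤ} (P : PivotPath k r) (σ τ : SignType)
    (t : Finset (Fin k)) :
    ∑ i ∈ t, (P.replace σ τ i : ℤ) = ∑ i ∈ t, (P.path.1 i : ℤ)
      + (if P.left ∈ t then (σ : ℤ) - 1 else 0) + (if P.right ∈ t then (τ : ℤ) + 1 else 0) := by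
  simp only [replace_apply, Finset.sum_add_distrib, Finset.sum_ite_eq']

theorem sum_Iic_split {k : ℕ} (a : Steps k) {j s : Fin k} (hjs : j ≤ s) :
    ∑ i ∈ Finset.Iic s, (a i : ℤ)
      = ∑ i ∈ Finset.Iio j, (a i : ℤ) + ∑ i ∈ Finset.Icc j s, (a i : ℤ) := by
  have hu : Finset.Iic s = Finset.Iio j ∪ Finset.Icc j s := by
    ext l
    simp only [Finset.mem_Iic, Finset.mem_union, Finset.mem_Iio, Finset.mem_Icc, Fin.le_def,
      Fin.lt_def] at *
    omega
  rw [hu, Finset.sum_union]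
  rw [Finset.disjoint_left]
  intro l h1 h2
  simp only [Finset.mem_Iio, Finset.mem_Icc, Fin.le_def, Fin.lt_def] at *
  omega

theorem sum_Iio_nonneg {k : ℕ} {r : ℤ} (p : Path k r) (j : Fin k) :
    0 ≤ ∑ i ∈ Finset.Iio j, (p.1 i : ℤ) := by
  by_cases h : (j : ℕ) = 0
  · have : Finset.Iio j = ∅ := by
      ext l
      simp only [Finset.mem_Iio, Fin.lt_def, Finset.notMem_empty, iff_false]
      omega
    simp [this]
  · have hj : (j : ℕ) - 1 < k := by have := j.2; omega
    have : Finset.Iio j = Finset.Iic ⟨j - 1, hj⟩ := by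
      ext l
      simp only [Finset.mem_Iio, Finset.mem_Iic, Fin.lt_def, Fin.le_def]
      omega
    rw [this]
    exact p.2.1 _

theorem isPath_replace {k : ℕ} {r : ℤ} (P : PivotPath k r) (σ τ : SignType)
    (hστ : (σ : ℤ) + (τ : ℤ) = 0)
    (h : ∀ s, P.left ≤ s → s < P.right →
      1 - (σ : ℤ) ≤ ∑ i ∈ Finset.Iic s, (P.path.1 i : ℤ)) :
    IsPath r (P.replace σ τ) := by
  constructor
  · intro s
    rw [sum_replace]
    have h0 := P.path.2.1 s
    simp only [Finset.mem_Iic]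
    by_cases h1 : P.left ≤ s
    · by_cases h2 : P.right ≤ s
      · simp only [h1, h2, if_true]; omega
      · have h3 := h s h1 (not_le.mp h2)
        simp only [h1, h2, if_true, if_false]; omega
    · have h2 : ¬ P.right ≤ s := fun h2 => h1 (P.lt.le.trans h2)
      simp only [h1, h2, if_false]; omega
  · rw [sum_replace, P.path.2.2]
    simp only [Finset.mem_univ, if_true]; omega

/-- The 1-factor `p_•`: the pivot edge is deleted, and its ends become isolated black vertices. -/
def bullet {k : ℕ} {r : ℤ} (P : PivotPath k r) : Path k r :=
  ⟨P.replace 0 0, P.isPath_replace 0 0 (by simp) fun s h1 h2 => by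
    have h3 := sum_Iic_split P.path.1 h1
    have h4 := sum_Iio_nonneg P.path P.left
    have h5 := P.sum_pos s h1 h2
    simp only [SignType.coe_zero]
    omega⟩

/-- `j` is the rightmost white vertex to the left of the pivot edge. -/
def IsNextWhite {k : ℕ} {r : ℤ} (P : PivotPath k r) (j : Fin k) : Prop :=
  j < P.left ∧ White P.path.1 j ∧ ∀ i, j < i → i < P.left → ¬ White P.path.1 i

/-- The 1-factor `p^(1)`, given the rightmost white vertex `j` to the left of the pivot edge: the
pivot edge is removed, a new pivot edge joins `j` to the left end of the old one, and the right end
of the old one becomes white. -/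
def shift {k : ℕ} {r : ℤ} (P : PivotPath k r) (j : Fin k) (hj : P.IsNextWhite j) :
    PivotPath k r where
  path := ⟨P.replace (-1) 1, P.isPath_replace (-1) 1 (by simp) fun s h1 h2 => by
    have h3 := sum_Iic_split P.path.1 h1
    have h4 := P.sum_pos s h1 h2
    have hlt := hj.1
    have hl : (P.left : ℕ) - 1 < k := by have := P.left.2; omega
    have h5 := hj.2.1.sum_pos (s := ⟨P.left - 1, hl⟩) (by
      simp only [Fin.le_def, Fin.lt_def] at *; omega)
    have h6 := sum_Iic_split P.path.1 (j := j) (s := ⟨P.left - 1, hl⟩) (by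
      simp only [Fin.le_def, Fin.lt_def] at *; omega)
    have h7 := sum_Iio_nonneg P.path j
    have h8 : Finset.Iio P.left = Finset.Iic ⟨P.left - 1, hl⟩ := by
      ext l
      simp only [Finset.mem_Iio, Finset.mem_Iic, Fin.lt_def, Fin.le_def] at *
      omega
    rw [h8] at h3
    simp only [SignType.coe_neg_one]
    omega⟩
  left := j
  right := P.left
  lt := hj.1
  left_eq := by
    have h1 : j ≠ P.left := hj.1.ne
    have h2 : j ≠ P.right := (hj.1.trans P.lt).ne
    simp [replace, h1, h2, hj.2.1.1]
  right_eq := by simp [replace, P.lt.ne]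
  sum_pos := by
    intro s h1 h2
    have h3 := hj.2.1.sum_pos h1
    dsimp only
    rw [sum_replace]
    have h4 : P.left ∉ Finset.Icc j s := by simp [h2]
    have h5 : P.right ∉ Finset.Icc j s := by simp [h2.trans P.lt]
    simpa [h4, h5] using h3

open Classical in
/-- The 1-factor `p^(1)`, or `none` (standing for `0`) if there is no white vertex to the left of
the pivot edge. -/
noncomputable def next {k : ℕ} {r : ℤ} (P : PivotPath k r) : Option (PivotPath k r) :=
  if h : ∃ j, P.IsNextWhite j then some (P.shift h.choose h.choose_spec) else none

end PivotPath

/-- The path `p`, ending in `-1`, whose pivot edge is the edge at the last vertex. -/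
noncomputable def initialPivot {n r : ℕ} (p : Path (n + 1) r) (h : p.1 (Fin.last n) = -1) :
    PivotPath (n + 1) r where
  path := p
  left := (exists_paired_last p h).choose
  right := Fin.last n
  lt := (exists_paired_last p h).choose_spec.1
  left_eq := (exists_paired_last p h).choose_spec.2.1
  right_eq := h
  sum_pos := fun _ h1 h2 => (exists_paired_last p h).choose_spec.sum_pos h1 h2

/-! ### The modified basis -/

/-- The rescaled Chebyshev polynomials of the second kind, evaluated at `y`:
`u_0 = 1`, `u_1 = y`, `u_k = y u_{k-1} - u_{k-2}`. -/
noncomputable def u {K : Type*} [Field K] (j : ℤ) (y : K) : K :=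
  (Polynomial.Chebyshev.S K j).eval y

/-- The recursion `[p] = p - p_• - (u_{s-1}(x-1) / u_s(x-1)) [p^(1)]`, in which `s` is lowered by one
in every step. For `s = 0` the last term vanishes, as `u_{-1} = 0`. -/
noncomputable def bracket {K : Type*} [Field K] (x : K) {k : ℕ} {r : ℤ} :
    ℕ → PivotPath k r → CellModule K k r
  | 0, P => Finsupp.single P.path 1 - Finsupp.single P.bullet 1
  | s + 1, P => Finsupp.single P.path 1 - Finsupp.single P.bullet 1 -
      (u (s : ℤ) (x - 1) / u ((s : ℤ) + 1) (x - 1)) •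
        (match P.next with
          | none => 0
          | some Q => bracket x s Q)

/-- The member of the modified basis that corresponds to a path `p` of length `n + 1` and rank `r`:
it is `[p]` if `p` ends in `-1`, and `p` itself otherwise. -/
noncomputable def modified {K : Type*} [Field K] (x : K) {n r : ℕ} (p : Path (n + 1) r) :
    CellModule K (n + 1) r :=
  if h : p.1 (Fin.last n) = -1 then bracket x r (initialPivot p h) else Finsupp.single p 1

/-- `q` is obtained from `p` by appending the last entry `σ`. -/
def IsAppend {n : ℕ} {r r' : ℤ} (p : Path n r') (σ : SignType) (q : Path (n + 1) r) : Prop :=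
  q.1 (Fin.last n) = σ ∧ ∀ i : Fin n, q.1 i.castSucc = p.1 i

end Motzkin

/-! Superpose the 1-factors of two paths p and q on a single row of vertices. In this meander every
vertex has degree at most 2, so the components are arcs and loops. The number ⟨p, q⟩ is x to the
number of loops if every white vertex of p is joined by an arc to a white vertex of q, and 0
otherwise (`gram_eq_pairing`).

Let p end in -1. Making both ends of its pivot edge white gives a sequence a of rank r + 2 with
white vertices w_0 < … < w_{r+1}. Each p^(t) arises from a by putting a cup on the consecutive
whites w_s, w_{s+1} with s = r - t, and its bullet by turning these two black. For fixed q let F(s)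
be the value of the form at their difference and q. Planarity (`not_joined_of_between`) makes F
vanish unless, for a necessarily unique m, the meander of a and q joins w_m to w_{m+1} and every
other w_c to a white vertex of q. If that meander has value c = x^κ, then F(m) = c(x - 1), as the
cup closes an arc to a new loop while the bullet does not; F(m ± 1) = c, as the cup straightens a
zigzag while the bullet gives 0; and F(s) = 0 otherwise (`pairing_link_sub`).

Thus F is c times column m of the tridiagonal matrix with x - 1 on the diagonal and 1 beside it,
whose leading principal minors are the u_j(x - 1). The recursion for [p] is Gaussian elimination on
this matrix: only m = r survives, with the pivot u_{r+1}/u_r (`bracket_recursion`,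
`cellForm_bracket`).

The case m = r requires that the last vertex w_{r+1} be joined to w_r. If q ends in 0 or 1, the last
vertex is isolated, so [p] is orthogonal to q. If q ends in -1, the condition says that after
opening both pivot edges all whites match up, which is the condition for the Gram entry of the
shortened paths of rank r + 1 (`cupAt_iff`). Since [q] - q is a combination of paths not ending in
-1, ⟨[p], [q]⟩ = ⟨[p], q⟩, and the change of basis is unipotent. The other two diagonal blocks come
from deleting an isolated last vertex. -/

namespace Motzkin

/-! ### Meanders of two involutions -/

section Meander

variable {V : Type*}

/-- The graph in which every vertex `v` is joined to `f v` and `g v`. -/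
def meander (f g : V → V) : SimpleGraph V :=
  SimpleGraph.fromRel fun v w => f v = w ∨ g v = w

/-- The vertices `v` and `w` lie in the same component of the meander of `f` and `g`. -/
def Joined (f g : V → V) (v w : V) : Prop := (meander f g).Reachable v w

theorem Joined.refl (f g : V → V) (v : V) : Joined f g v v := SimpleGraph.Reachable.refl v

theorem Joined.symm {f g : V → V} {v w : V} (h : Joined f g v w) : Joined f g w v :=
  SimpleGraph.Reachable.symm h

theorem Joined.trans {f g : V → V} {v w z : V} (h : Joined f g v w) (h' : Joined f g w z) :
    Joined f g v z :=
  SimpleGraph.Reachable.trans h h'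

theorem joined_left (f g : V → V) (v : V) : Joined f g v (f v) := by
  by_cases h : v = f v
  · rw [← h]; exact Joined.refl f g v
  · exact SimpleGraph.Adj.reachable ⟨h, Or.inl (Or.inl rfl)⟩

theorem joined_right (f g : V → V) (v : V) : Joined f g v (g v) := by
  by_cases h : v = g v
  · rw [← h]; exact Joined.refl f g v
  · exact SimpleGraph.Adj.reachable ⟨h, Or.inl (Or.inr rfl)⟩

theorem joined_comm {f g : V → V} {v w : V} : Joined f g v w ↔ Joined g f v w := by
  have : meander f g = meander g f := by
    ext a b
    simp only [meander, SimpleGraph.fromRel_adj, or_comm]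
  rw [Joined, Joined, this]

theorem meander_adj {f g : V → V} (hf : f.Involutive) (hg : g.Involutive) {v w : V} :
    (meander f g).Adj v w ↔ v ≠ w ∧ (w = f v ∨ w = g v) := by
  have h₁ := hf.eq_iff (x := w) (y := v)
  have h₂ := hg.eq_iff (x := w) (y := v)
  simp only [meander, SimpleGraph.fromRel_adj]
  grind

theorem Joined.induction {f g : V → V} (hf : f.Involutive) (hg : g.Involutive) {P : V → Prop}
    (h₁ : ∀ v, P v → P (f v)) (h₂ : ∀ v, P v → P (g v)) {v w : V} (h : Joined f g v w)
    (hv : P v) : P w := by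
  obtain ⟨p⟩ := h
  induction p with
  | nil => exact hv
  | cons hadj _ ih =>
    apply ih
    rcases ((meander_adj hf hg).1 hadj).2 with rfl | rfl
    · exact h₁ _ hv
    · exact h₂ _ hv

variable [Fintype V]

open Classical in
/-- The component of `v`, as a finite set. -/
noncomputable def component (f g : V → V) (v : V) : Finset V :=
  Finset.univ.filter fun w => Joined f g v w

theorem mem_component {f g : V → V} {v w : V} : w ∈ component f g v ↔ Joined f g v w := by
  simp [component]

theorem component_comm (f g : V → V) (v : V) : component f g v = component g f v := by
  ext w
  rw [mem_component, mem_component, joined_comm]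

open Classical in
-- A component has at most two ends. Connectedness forces a degree sum of at least 2|C| - 2, while
-- each vertex has degree at most 2, less one for each of the two maps that fixes it. A vertex fixed
-- by both counts twice.
theorem card_fixed_le {f g : V → V} (hf : f.Involutive) (hg : g.Involutive) (v : V) :
    ((component f g v).filter fun w => f w = w).card
      + ((component f g v).filter fun w => g w = w).card ≤ 2 := by
  let C := (meander f g).connectedComponentMk v
  have hC : ∀ w, w ∈ C ↔ w ∈ component f g v := by
    intro w
    rw [mem_component]
    exact ⟨fun h => (SimpleGraph.ConnectedComponent.exact h).symm,
      fun h => SimpleGraph.ConnectedComponent.sound h.symm⟩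
  have hcard (P : V → Prop) : ((component f g v).filter P).card
      = ∑ t : C, if P t then 1 else 0 := by
    rw [← Finset.card_filter]
    symm
    refine Finset.card_bij (fun t _ => (t : V)) ?_ ?_ ?_
    · intro t ht
      simp only [Finset.mem_filter, Finset.mem_univ, true_and] at ht ⊢
      exact ⟨(hC t).1 t.2, ht⟩
    · intro s _ t _ h
      exact Subtype.ext h
    · intro w hw
      rw [Finset.mem_filter] at hw
      exact ⟨⟨w, (hC w).2 hw.1⟩, by simpa using hw.2, rfl⟩
  have hconn := C.connected_toSimpleGraph.card_vert_le_card_edgeSet_add_one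
  have hdeg := C.toSimpleGraph.sum_degrees_eq_twice_card_edges
  rw [Nat.card_eq_fintype_card, Nat.card_eq_fintype_card,
    ← SimpleGraph.edgeFinset_card] at hconn
  have hle : ∀ t : C, C.toSimpleGraph.degree t
      + ((if f t = t then 1 else 0) + (if g t = t then 1 else 0)) ≤ 2 := by
    intro t
    have hsub : (C.toSimpleGraph.neighborFinset t).map (Function.Embedding.subtype _)
        ⊆ ({f t, g t} : Finset V).erase t := by
      intro w hw
      simp only [Finset.mem_map, SimpleGraph.mem_neighborFinset] at hw
      obtain ⟨s, hs, rfl⟩ := hw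
      have := (meander_adj hf hg).1 (show (meander f g).Adj t s from hs)
      simp only [Finset.mem_erase, Finset.mem_insert, Finset.mem_singleton]
      exact ⟨this.1.symm, this.2⟩
    have h := Finset.card_le_card hsub
    rw [Finset.card_map, SimpleGraph.card_neighborFinset_eq_degree] at h
    have h2 : (({f t, g t} : Finset V).erase t).card
        + ((if f t = t then 1 else 0) + (if g t = t then 1 else 0)) ≤ 2 := by
      have h3 := Finset.card_le_two (a := f t) (b := g t)
      by_cases hft : f t = t <;> by_cases hgt : g t = t
      · simp [hft, hgt]
      · have : (({f t, g t} : Finset V).erase t).card ≤ ({g t} : Finset V).card :=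
          Finset.card_le_card (by rw [hft]; intro; simp)
        simpa only [hft, hgt, if_true, if_false, Finset.card_singleton, add_zero, zero_add,
          Nat.reduceLeDiff, ge_iff_le] using Nat.add_le_add_right this 1
      · have : (({f t, g t} : Finset V).erase t).card ≤ ({f t} : Finset V).card :=
          Finset.card_le_card (by rw [hgt]; intro; simp; tauto)
        simpa only [hft, hgt, if_true, if_false, Finset.card_singleton, add_zero, zero_add,
          Nat.reduceLeDiff, ge_iff_le] using Nat.add_le_add_right this 1
      · have := Finset.card_erase_le (a := (t : V)) (s := {f t, g t})
        simp only [hft, hgt, if_false]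
        omega
    omega
  have hsum := Finset.sum_le_sum fun t (_ : t ∈ Finset.univ) => hle t
  rw [Finset.sum_add_distrib, Finset.sum_add_distrib, hdeg, ← hcard fun w => f w = w,
    ← hcard fun w => g w = w,
    Finset.sum_const, Finset.card_univ, smul_eq_mul] at hsum
  omega

omit [Fintype V] in
-- The non-fixed points of `S` come in pairs; their number is computed as a sum of ones that cancels
-- in `ZMod 2`.
theorem card_fixed_modEq [DecidableEq V] {f : V → V} (hf : f.Involutive) {S : Finset V}
    (hS : ∀ v ∈ S, f v ∈ S) : S.card % 2 = (S.filter fun w => f w = w).card % 2 := by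
  have h : ∑ v ∈ S.filter (fun w => ¬ f w = w), (1 : ZMod 2) = 0 := by
    refine Finset.sum_involution (fun v _ => f v) ?_ ?_ ?_ ?_
    · intros; decide
    · intro a ha _
      exact (Finset.mem_filter.1 ha).2
    · intro a ha
      rw [Finset.mem_filter] at ha ⊢
      exact ⟨hS a ha.1, fun h => ha.2 (hf.injective h)⟩
    · intro a _
      exact hf a
  rw [Finset.sum_const, nsmul_eq_mul, mul_one, ZMod.natCast_eq_zero_iff] at h
  have := Finset.card_filter_add_card_filter_not (s := S) (fun w => f w = w)
  omega

theorem component_closed {f g : V → V} {v w : V} (h : w ∈ component f g v) :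
    f w ∈ component f g v ∧ g w ∈ component f g v := by
  rw [mem_component] at h ⊢
  rw [mem_component]
  exact ⟨h.trans (joined_left f g w), h.trans (joined_right f g w)⟩

/-! ### Ends of the components of a meander -/

section Ends

variable {f g : V → V} (hf : f.Involutive) (hg : g.Involutive) {a b c : V}

include hf hg

/-- The size of the component is congruent mod 2 both to its number of `f`-fixed points and to its
number of `g`-fixed points, so `a` cannot be the only end. The end found may be `a` itself, if `g`
fixes it too. -/
theorem exists_other_end (ha : f a = a) :
    ∃ u, Joined f g a u ∧ (u ≠ a ∧ f u = u ∨ g u = u) := by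
  classical
  by_contra! hcon
  have h₁ := card_fixed_modEq hf fun w hw => (component_closed (f := f) (g := g) (v := a) hw).1
  have h₂ := card_fixed_modEq hg fun w hw => (component_closed (f := f) (g := g) (v := a) hw).2
  have h₃ : (component f g a).filter (fun w => f w = w) = {a} := by
    ext w
    simp only [Finset.mem_filter, mem_component, Finset.mem_singleton]
    refine ⟨fun h => by_contra fun hne => (hcon w h.1).1 hne h.2, ?_⟩
    rintro rfl
    exact ⟨Joined.refl _ _ _, ha⟩
  have h₄ : (component f g a).filter (fun w => g w = w) = ∅ := by
    refine Finset.filter_eq_empty_iff.2 fun w hw => (hcon w (mem_component.1 hw)).2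
  rw [h₃] at h₁
  rw [h₄] at h₂
  simp at h₁ h₂
  omega

theorem not_three_left_fixed (ha : f a = a) (hb : f b = b) (hc : f c = c) (hab : a ≠ b)
    (hac : a ≠ c) (hbc : b ≠ c) (h : Joined f g a b) (h' : Joined f g a c) : False := by
  classical
  have h₁ := card_fixed_le hf hg a
  have h₂ : ({a, b, c} : Finset V).card ≤
      ((component f g a).filter fun w => f w = w).card := by
    refine Finset.card_le_card fun w hw => ?_
    simp only [Finset.mem_insert, Finset.mem_singleton] at hw
    rw [Finset.mem_filter, mem_component]
    rcases hw with rfl | rfl | rfl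
    · exact ⟨Joined.refl _ _ _, ha⟩
    · exact ⟨h, hb⟩
    · exact ⟨h', hc⟩
  rw [Finset.card_eq_three.2 ⟨a, b, c, hab, hac, hbc, rfl⟩] at h₂
  omega

theorem not_right_fixed (ha : f a = a) (hb : f b = b) (hc : g c = c) (hab : a ≠ b)
    (h : Joined f g a b) (h' : Joined f g a c) : False := by
  classical
  have h₁ := card_fixed_le hf hg a
  have h₂ : ({a, b} : Finset V).card ≤
      ((component f g a).filter fun w => f w = w).card := by
    refine Finset.card_le_card fun w hw => ?_
    simp only [Finset.mem_insert, Finset.mem_singleton] at hw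
    rw [Finset.mem_filter, mem_component]
    rcases hw with rfl | rfl
    · exact ⟨Joined.refl _ _ _, ha⟩
    · exact ⟨h, hb⟩
  have h₃ : ({c} : Finset V).card ≤
      ((component f g a).filter fun w => g w = w).card := by
    refine Finset.card_le_card fun w hw => ?_
    rw [Finset.mem_singleton] at hw
    rw [Finset.mem_filter, mem_component, hw]
    exact ⟨h', hc⟩
  rw [Finset.card_pair hab] at h₂
  simp only [Finset.card_singleton] at h₃
  omega

theorem eq_of_joined_left_fixed (ha : f a = a) (hb : f b = b) (hc : g c = c)
    (h : Joined f g a c) (h' : Joined f g b c) : a = b :=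
  by_contra fun hab => not_right_fixed hf hg ha hb hc hab (h.trans h'.symm) h

theorem eq_of_joined_right_fixed (ha : f a = a) (hb : g b = b) (hc : g c = c)
    (h : Joined f g a b) (h' : Joined f g a c) : b = c :=
  eq_of_joined_left_fixed hg hf hb hc ha (joined_comm.1 h.symm) (joined_comm.1 h'.symm)

end Ends

/-! ### Planarity -/

section Planar

variable [LinearOrder V]

/-- The arcs joining the points `v` to `f v` above a line do not cross. -/
def Noncrossing (f : V → V) : Prop :=
  ∀ u v, u < v → v < f u → u < f v ∧ f v < f u

/-- The point `w` lies below none of the arcs of `f`. -/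
def Exposed (f : V → V) (w : V) : Prop :=
  f w = w ∧ ∀ u, u < w → ¬ w < f u

open Classical in
/-- The number of points of the component of `a` to the left of `v`. -/
noncomputable def leftCount (f g : V → V) (a v : V) : ℕ :=
  ((component f g a).filter fun u => u < v).card

open Classical in
/-- The number of arcs of `f` above `v` that belong to the component of `a`. -/
noncomputable def coverCount (f g : V → V) (a v : V) : ℕ :=
  ((component f g a).filter fun u => u < v ∧ v < f u).card

/-- By noncrossing, an arc that passes over one end of another arc passes over both. -/
theorem coverCount_apply {f g : V → V} (hf : f.Involutive) (hnc : Noncrossing f) (a v : V) :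
    coverCount f g a (f v) = coverCount f g a v := by
  unfold coverCount
  congr 1
  ext u
  simp only [Finset.mem_filter, mem_component]
  refine and_congr_right fun _ => ⟨fun h => ?_, fun h => hnc u v h.1 h.2⟩
  have := hnc u (f v) h.1 h.2
  rwa [hf v] at this

open Classical in
-- Of the points to the left of `v`, those whose arc does not pass over `v` are permuted by `f`,
-- since no arc of this component ends at `v`. Their number therefore has the parity of the number
-- of fixed points among them.
theorem leftCount_mod {f g : V → V} (hf : f.Involutive) {a v : V} (hv : ¬ Joined f g a v) :
    leftCount f g a v % 2 = (coverCount f g a v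
      + ((component f g a).filter fun u => f u = u ∧ u < v).card) % 2 := by
  have hne : ∀ u, Joined f g a u → f u ≠ v := by
    rintro u hu rfl
    exact hv (hu.trans (joined_left f g u))
  have h₁ := Finset.card_filter_add_card_filter_not
    (s := (component f g a).filter fun u => u < v) (fun u => v < f u)
  have h₂ := card_fixed_modEq hf (S := ((component f g a).filter fun u => u < v).filter
    fun u => ¬ v < f u) (by
      intro u hu
      simp only [Finset.mem_filter, not_lt] at hu ⊢
      refine ⟨⟨(component_closed hu.1.1).1, lt_of_le_of_ne hu.2 (hne u (mem_component.1 hu.1.1))⟩,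
        ?_⟩
      rw [hf u]
      exact hu.1.2.le)
  have h₃ : (((component f g a).filter fun u => u < v).filter fun u => ¬ v < f u).filter
      (fun u => f u = u) = (component f g a).filter fun u => f u = u ∧ u < v := by
    ext u
    simp only [Finset.mem_filter, not_lt]
    constructor
    · tauto
    · rintro ⟨h, h', h''⟩
      exact ⟨⟨⟨h, h''⟩, by rw [h']; exact h''.le⟩, h'⟩
  rw [h₃] at h₂
  rw [Finset.filter_filter] at h₁
  unfold leftCount coverCount
  omega

/-- If two exposed points of `f` are joined, then no point between them that is exposed for `f`
is joined to an exposed point of `g`. -/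
theorem not_joined_of_between {f g : V → V} (hf : f.Involutive) (hg : g.Involutive)
    (hfn : Noncrossing f) (hgn : Noncrossing g) {a b c w : V} (ha : Exposed f a)
    (hb : Exposed f b) (hc : Exposed f c) (hw : Exposed g w) (hab : Joined f g a b)
    (hac : a < c) (hcb : c < b) : ¬ Joined f g c w := by
  classical
  -- A discrete Jordan curve argument: the number of points of the arc from `a` to `b` to the left
  -- of `v` has constant parity as `v` runs through the component of `c`. Counted with `f` it is odd
  -- at `c`; counted with `g` it is even at `w`.
  intro hcw
  have hne := (hac.trans hcb).ne
  have hout : ∀ v, Joined f g c v → ¬ Joined f g a v := fun v hv h =>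
    not_three_left_fixed hf hg ha.1 hb.1 hc.1 hne hac.ne hcb.ne' hab (h.trans hv.symm)
  have hfix : ∀ v, (component f g a).filter (fun u => f u = u ∧ u < v)
      = ({a, b} : Finset V).filter (fun u => u < v) := by
    intro v
    ext u
    simp only [Finset.mem_filter, mem_component, Finset.mem_insert, Finset.mem_singleton]
    constructor
    · rintro ⟨h, h', h''⟩
      refine ⟨?_, h''⟩
      by_contra! hu
      exact not_three_left_fixed hf hg ha.1 hb.1 h' hne hu.1.symm hu.2.symm hab h
    · rintro ⟨rfl | rfl, h⟩
      · exact ⟨Joined.refl _ _ _, ha.1, h⟩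
      · exact ⟨hab, hb.1, h⟩
  -- The ends `a` and `b` are both fixed by `f`, which leaves no end for `g`.
  have hgfix : ∀ v, (component f g a).filter (fun u => g u = u ∧ u < v) = ∅ := by
    refine fun v => Finset.filter_eq_empty_iff.2 fun u hu h => ?_
    exact not_right_fixed hf hg ha.1 hb.1 h.1 hne hab (mem_component.1 hu)
  have hL : ∀ v, Joined f g c v → leftCount f g a v % 2
      = (coverCount f g a v + (({a, b} : Finset V).filter fun u => u < v).card) % 2 := by
    intro v hv
    rw [leftCount_mod hf (hout v hv), hfix]
  have hR : ∀ v, Joined f g c v → leftCount f g a v % 2 = coverCount g f a v % 2 := by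
    intro v hv
    have := leftCount_mod (f := g) (g := f) hg fun h => hout v hv (joined_comm.1 h)
    rw [component_comm g f, hgfix, Finset.card_empty, add_zero] at this
    rw [← this, leftCount, leftCount, component_comm]
  -- No arc passes over an exposed point, so `v` and `f v` lie on the same side of it.
  have hcov : ∀ d, Exposed f d → ∀ v, f v ≠ d → v ≠ d → (d < f v ↔ d < v) := by
    intro d hd v h₁ h₂
    constructor
    · intro h
      by_contra h'
      exact hd.2 v (lt_of_le_of_ne (not_lt.1 h') h₂) h
    · intro h
      by_contra h'
      exact hd.2 (f v) (lt_of_le_of_ne (not_lt.1 h') h₁) (by rwa [hf v])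
  have hinv : Joined f g c w ∧ leftCount f g a w % 2 = 1 := by
    refine Joined.induction hf hg
      (P := fun v => Joined f g c v ∧ leftCount f g a v % 2 = 1) ?_ ?_ hcw ⟨Joined.refl _ _ _, ?_⟩
    · rintro v ⟨hv, h⟩
      have hv' := hv.trans (joined_left f g v)
      refine ⟨hv', ?_⟩
      rw [← h, hL v hv, hL _ hv', coverCount_apply hf hfn]
      congr 3
      ext u
      simp only [Finset.mem_filter, Finset.mem_insert, Finset.mem_singleton]
      refine and_congr_right ?_
      have h1 : ∀ d, Joined f g a d → f v ≠ d := by rintro d hd rfl; exact hout _ hv' hd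
      have h2 : ∀ d, Joined f g a d → v ≠ d := by rintro d hd rfl; exact hout _ hv hd
      rintro (rfl | rfl)
      · exact hcov _ ha v (h1 _ (Joined.refl _ _ _)) (h2 _ (Joined.refl _ _ _))
      · exact hcov _ hb v (h1 _ hab) (h2 _ hab)
    · rintro v ⟨hv, h⟩
      have hv' := hv.trans (joined_right f g v)
      refine ⟨hv', ?_⟩
      rw [← h, hR v hv, hR _ hv',
        coverCount_apply hg hgn]
    · rw [hL c (Joined.refl _ _ _)]
      have h₁ : coverCount f g a c = 0 := by
        refine Finset.card_eq_zero.2 (Finset.filter_eq_empty_iff.2 fun u _ h => ?_)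
        exact hc.2 u h.1 h.2
      have h₂ : ({a, b} : Finset V).filter (fun u => u < c) = {a} := by
        ext u
        simp only [Finset.mem_filter, Finset.mem_insert, Finset.mem_singleton]
        constructor
        · rintro ⟨rfl | rfl, h⟩
          · rfl
          · exact absurd h hcb.not_gt
        · rintro rfl
          exact ⟨Or.inl rfl, hac⟩
      rw [h₁, h₂, Finset.card_singleton]
  rw [hR w hcw] at hinv
  have h₁ : coverCount g f a w = 0 := by
    refine Finset.card_eq_zero.2 (Finset.filter_eq_empty_iff.2 fun u _ h => ?_)
    exact hw.2 u h.1 h.2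
  rw [h₁] at hinv
  exact absurd hinv.2 (by norm_num)

end Planar

end Meander

/-! ### Linking two fixed points -/

section Link

variable {V : Type*}

theorem Joined.step_left {f g : V → V} {v w : V} (h : Joined f g v w) : Joined f g v (f w) :=
  h.trans (joined_left f g w)

theorem Joined.step_right {f g : V → V} {v w : V} (h : Joined f g v w) : Joined f g v (g w) :=
  h.trans (joined_right f g w)

open Classical in
/-- The map that exchanges `i` and `j`, and agrees with `f` elsewhere. -/
noncomputable def link (f : V → V) (i j : V) (v : V) : V :=
  if v = i then j else if v = j then i else f v

theorem link_left (f : V → V) (i j : V) : link f i j i = j := by simp [link]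

theorem link_right (f : V → V) (i j : V) : link f i j j = i := by
  unfold link
  by_cases h : j = i <;> simp [h]

theorem link_of_ne (f : V → V) {i j v : V} (hi : v ≠ i) (hj : v ≠ j) : link f i j v = f v := by
  simp [link, hi, hj]

variable {f g : V → V} {i j : V}

theorem link_involutive (hf : f.Involutive) (hi : f i = i) (hj : f j = j) :
    (link f i j).Involutive := by
  intro v
  by_cases h₁ : v = i
  · rw [h₁, link_left, link_right]
  by_cases h₂ : v = j
  · rw [h₂, link_right, link_left]
  rw [link_of_ne f h₁ h₂, link_of_ne f, hf v]
  · exact fun h => h₁ (by rw [← hf v, h, hi])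
  · exact fun h => h₂ (by rw [← hf v, h, hj])

variable (hf : f.Involutive) (hg : g.Involutive) (hi : f i = i) (hj : f j = j)

include hf hg hi hj

/-- Linking loses no connection, because the steps of `f` at the fixed points `i` and `j` were
trivial. -/
theorem Joined.to_link {v w : V} (h : Joined f g v w) : Joined (link f i j) g v w := by
  refine Joined.induction hf hg (P := fun w => Joined (link f i j) g v w) ?_
    (fun w hw => hw.step_right) h (Joined.refl _ _ _)
  intro w hw
  by_cases h₁ : w = i
  · rw [h₁] at hw ⊢
    rwa [hi]
  by_cases h₂ : w = j
  · rw [h₂] at hw ⊢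
    rwa [hj]
  rw [← link_of_ne f h₁ h₂]
  exact hw.step_left

theorem joined_link {v w : V} : Joined (link f i j) g v w ↔
    Joined f g v w ∨ Joined f g v i ∧ Joined f g j w ∨ Joined f g v j ∧ Joined f g i w := by
  have hij : Joined (link f i j) g i j := by
    have := joined_left (link f i j) g i
    rwa [link_left] at this
  constructor
  · intro h
    refine Joined.induction (link_involutive hf hi hj) hg (P := fun w => Joined f g v w ∨
      Joined f g v i ∧ Joined f g j w ∨ Joined f g v j ∧ Joined f g i w) ?_ ?_ h
      (Or.inl (Joined.refl _ _ _))
    · intro w hw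
      by_cases h₁ : w = i
      · subst h₁
        rw [link_left]
        rcases hw with hw | ⟨hw, -⟩ | ⟨hw, -⟩
        · exact Or.inr (Or.inl ⟨hw, Joined.refl _ _ _⟩)
        · exact Or.inr (Or.inl ⟨hw, Joined.refl _ _ _⟩)
        · exact Or.inl hw
      by_cases h₂ : w = j
      · subst h₂
        rw [link_right]
        rcases hw with hw | ⟨hw, -⟩ | ⟨hw, -⟩
        · exact Or.inr (Or.inr ⟨hw, Joined.refl _ _ _⟩)
        · exact Or.inl hw
        · exact Or.inr (Or.inr ⟨hw, Joined.refl _ _ _⟩)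
      rw [link_of_ne f h₁ h₂]
      exact hw.imp Joined.step_left
        (Or.imp (And.imp_right Joined.step_left) (And.imp_right Joined.step_left))
    · intro w hw
      exact hw.imp Joined.step_right
        (Or.imp (And.imp_right Joined.step_right) (And.imp_right Joined.step_right))
  · rintro (h | ⟨h, h'⟩ | ⟨h, h'⟩)
    · exact h.to_link hf hg hi hj
    · exact (h.to_link hf hg hi hj).trans (hij.trans (h'.to_link hf hg hi hj))
    · exact (h.to_link hf hg hi hj).trans (hij.symm.trans (h'.to_link hf hg hi hj))

theorem joined_link_of_joined (hij : Joined f g i j) {v w : V} :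
    Joined (link f i j) g v w ↔ Joined f g v w := by
  rw [joined_link hf hg hi hj]
  refine ⟨?_, Or.inl⟩
  rintro (h | ⟨h, h'⟩ | ⟨h, h'⟩)
  · exact h
  · exact h.trans (hij.trans h')
  · exact h.trans (hij.symm.trans h')

end Link

/-! ### Loops -/

section Loops

variable {V : Type*}

/-- The components of the meander in which no vertex is fixed by `f` or by `g`. -/
def loopSet (f g : V → V) : Set (Set V) :=
  {S | ∃ v, S = {w | Joined f g v w} ∧ ∀ w ∈ S, f w ≠ w ∧ g w ≠ w}

theorem loopSet_comm (f g : V → V) : loopSet f g = loopSet g f := by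
  ext S
  simp only [loopSet, Set.mem_ofPred_eq, joined_comm (f := f) (g := g), and_comm]

variable [Fintype V] {f g : V → V} {i j : V} (hf : f.Involutive) (hg : g.Involutive)
  (hi : f i = i) (hj : f j = j) (hne : i ≠ j)

include hf hg hi hj hne

/-- The component of `i` is an arc whose only ends are `i` and `j`; the link closes it into the one
new loop. -/
theorem ncard_loopSet_link_of_joined (hij : Joined f g i j) :
    (loopSet (link f i j) g).ncard = (loopSet f g).ncard + 1 := by
  have hnot : {w | Joined f g i w} ∉ loopSet f g := by
    rintro ⟨v, -, h⟩
    exact (h i (Joined.refl _ _ _)).1 hi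
  rw [← Set.ncard_insert_of_notMem hnot (Set.toFinite _)]
  congr 1
  ext S
  simp only [loopSet, Set.mem_insert_iff, Set.mem_ofPred_eq, joined_link_of_joined hf hg hi hj hij]
  constructor
  · rintro ⟨v, rfl, h⟩
    by_cases hv : Joined f g i v
    · left
      ext w
      exact ⟨fun h => hv.trans h, fun h => hv.symm.trans h⟩
    · refine Or.inr ⟨v, rfl, fun w hw => ?_⟩
      have h₁ : w ≠ i := by rintro rfl; exact hv hw.symm
      have h₂ : w ≠ j := by rintro rfl; exact hv (hij.trans (Joined.symm hw))
      have := h w hw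
      rwa [link_of_ne f h₁ h₂] at this
  · rintro (rfl | ⟨v, rfl, h⟩)
    · refine ⟨i, rfl, fun w hw => ⟨fun h => ?_, fun h => ?_⟩⟩
      · have h₁ : w ≠ i := by rintro rfl; rw [link_left] at h; exact hne h.symm
        have h₂ : w ≠ j := by rintro rfl; rw [link_right] at h; exact hne h
        rw [link_of_ne f h₁ h₂] at h
        exact not_three_left_fixed hf hg hi hj h hne h₁.symm h₂.symm hij hw
      · exact not_right_fixed hf hg hi hj h hne hij hw
    · refine ⟨v, rfl, fun w hw => ?_⟩
      have h₁ : w ≠ i := by rintro rfl; exact (h w hw).1 hi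
      have h₂ : w ≠ j := by rintro rfl; exact (h w hw).1 hj
      rw [link_of_ne f h₁ h₂]
      exact h w hw

/-- Two arcs merge into one. The far end of the arc starting at `i` survives, so the merged
component is not a loop. -/
theorem loopSet_link_of_not_joined (hij : ¬ Joined f g i j) :
    loopSet (link f i j) g = loopSet f g := by
  have hclass : ∀ v, ¬ Joined f g v i → ¬ Joined f g v j →
      {w | Joined (link f i j) g v w} = {w | Joined f g v w} := by
    intro v h₁ h₂
    ext w
    simp [joined_link hf hg hi hj, h₁, h₂]
  ext S
  constructor
  · rintro ⟨v, rfl, h⟩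
    have h₁ : ¬ Joined (link f i j) g v i := by
      intro hv
      obtain ⟨u, hu, hu' | hu'⟩ := exists_other_end hf hg hi
      · refine (h u (hv.trans (hu.to_link hf hg hi hj))).1 ?_
        rw [link_of_ne f hu'.1, hu'.2]
        rintro rfl
        exact hij hu
      · exact (h u (hv.trans (hu.to_link hf hg hi hj))).2 hu'
    have h₂ : ¬ Joined (link f i j) g v j := by
      intro hv
      have := hv.step_left
      rw [link_right] at this
      exact h₁ this
    have h₃ := hclass v (fun h => h₁ (h.to_link hf hg hi hj)) fun h => h₂ (h.to_link hf hg hi hj)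
    refine ⟨v, h₃, fun w hw => ?_⟩
    have h₄ : w ≠ i := by rintro rfl; exact h₁ hw
    have h₅ : w ≠ j := by rintro rfl; exact h₂ hw
    have := h w hw
    rwa [link_of_ne f h₄ h₅] at this
  · rintro ⟨v, rfl, h⟩
    have h₁ : ¬ Joined f g v i := fun hv => (h i hv).1 hi
    have h₂ : ¬ Joined f g v j := fun hv => (h j hv).1 hj
    refine ⟨v, (hclass v h₁ h₂).symm, fun w hw => ?_⟩
    have h₄ : w ≠ i := by rintro rfl; exact h₁ hw
    have h₅ : w ≠ j := by rintro rfl; exact h₂ hw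
    rw [link_of_ne f h₄ h₅]
    exact h w hw

end Loops

/-! ### The pairing of two involutions with marked fixed points -/

section Pairing

variable {V K : Type*} [Field K]

open Classical in
/-- The value `x ^ κ`, with `κ` the number of loops, if every point of `W` is joined to a point
of `W'`, and `0` otherwise. -/
noncomputable def pairing (x : K) (f g : V → V) (W W' : Set V) : K :=
  if ∀ v ∈ W, ∃ w ∈ W', Joined f g v w then x ^ (loopSet f g).ncard else 0

/-- The marked points `w m` and `w (m + 1)` are joined to each other, and all other `w c` with
`c ≤ N` are joined to points of `W'`. -/
def CupAt (f g : V → V) (W' : Set V) (w : ℕ → V) (N m : ℕ) : Prop :=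
  Joined f g (w m) (w (m + 1)) ∧
    ∀ c ≤ N, c ≠ m → c ≠ m + 1 → ∃ z ∈ W', Joined f g (w c) z

variable [LinearOrder V] {f g : V → V} {W' : Set V} {w : ℕ → V} {N : ℕ}

/-- The data on which the contractions of adjacent marked points are computed. -/
structure Marked (f g : V → V) (W' : Set V) (w : ℕ → V) (N : ℕ) : Prop where
  left_inv : f.Involutive
  right_inv : g.Involutive
  left_nc : Noncrossing f
  right_nc : Noncrossing g
  mono : ∀ a b, a < b → b ≤ N → w a < w b
  left_exposed : ∀ a ≤ N, Exposed f (w a)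
  right_exposed : ∀ z ∈ W', Exposed g z

namespace Marked

variable (h : Marked f g W' w N)

include h

theorem fixed {a : ℕ} (ha : a ≤ N) : f (w a) = w a := (h.left_exposed a ha).1

theorem ne {a b : ℕ} (hab : a ≠ b) (ha : a ≤ N) (hb : b ≤ N) : w a ≠ w b := by
  rcases lt_or_gt_of_ne hab with h' | h'
  · exact (h.mono a b h' hb).ne
  · exact (h.mono b a h' ha).ne'

/-- The set of marked points other than `w s` and `w (s + 1)`. -/
theorem others_iff {P : V → Prop} {s : ℕ} (hs : s + 1 ≤ N) :
    (∀ v ∈ (w '' Set.Iic N) \ {w s, w (s + 1)}, P v) ↔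
      ∀ c ≤ N, c ≠ s → c ≠ s + 1 → P (w c) := by
  constructor
  · intro H c hc h₁ h₂
    refine H _ ⟨⟨c, hc, rfl⟩, ?_⟩
    simp only [Set.mem_insert_iff, Set.mem_singleton_iff, not_or]
    exact ⟨h.ne h₁ hc (by omega), h.ne h₂ hc hs⟩
  · rintro H _ ⟨⟨c, hc, rfl⟩, h'⟩
    simp only [Set.mem_insert_iff, Set.mem_singleton_iff, not_or] at h'
    exact H c hc (by rintro rfl; exact h'.1 rfl) (by rintro rfl; exact h'.2 rfl)

variable [Fintype V]

theorem not_three {a b c : ℕ} (hab : a ≠ b) (hac : a ≠ c) (hbc : b ≠ c) (ha : a ≤ N) (hb : b ≤ N)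
    (hc : c ≤ N) (h₁ : Joined f g (w a) (w b)) (h₂ : Joined f g (w a) (w c)) : False :=
  not_three_left_fixed h.left_inv h.right_inv (h.fixed ha) (h.fixed hb) (h.fixed hc)
    (h.ne hab ha hb) (h.ne hac ha hc) (h.ne hbc hb hc) h₁ h₂

theorem not_right {a b : ℕ} (hab : a ≠ b) (ha : a ≤ N) (hb : b ≤ N)
    (h₁ : Joined f g (w a) (w b)) : ¬ ∃ z ∈ W', Joined f g (w a) z := by
  rintro ⟨z, hz, h₂⟩
  exact not_right_fixed h.left_inv h.right_inv (h.fixed ha) (h.fixed hb) (h.right_exposed z hz).1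
    (h.ne hab ha hb) h₁ h₂

theorem between {a b c : ℕ} (hac : a < c) (hcb : c < b) (hb : b ≤ N)
    (h₁ : Joined f g (w a) (w b)) : ¬ ∃ z ∈ W', Joined f g (w c) z := by
  rintro ⟨z, hz, h₂⟩
  exact not_joined_of_between h.left_inv h.right_inv h.left_nc h.right_nc
    (h.left_exposed a (by omega)) (h.left_exposed b hb) (h.left_exposed c (by omega))
    (h.right_exposed z hz) h₁ (h.mono a c hac (by omega)) (h.mono c b hcb hb) h₂

/-- For two different cups, an end of one of them would also have to reach `W'`, giving an arc with
three ends. -/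
theorem cupAt_unique {m m' : ℕ} (hm : m + 1 ≤ N) (h₁ : CupAt f g W' w N m)
    (h₂ : CupAt f g W' w N m') : m = m' := by
  by_contra hne
  by_cases hlt : m < m'
  · exact h.not_right (a := m) (b := m + 1) (by omega) (by omega) hm h₁.1
      (h₂.2 m (by omega) hne (by omega))
  · exact h.not_right (a := m + 1) (b := m) (by omega) (by omega) (by omega) h₁.1.symm
      (h₂.2 (m + 1) hm (by omega) (by omega))

open Classical in
-- This is one column of the tridiagonal matrix. A cup on `w s` and `w (s + 1)` changes the pairing
-- only if it closes an arc into a loop, or if it prolongs an arc from a neighbouring marked point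
-- so that this point reaches `W'`. The condition `∃ m, m + 1 = s` stands for `m = s - 1` without
-- truncated subtraction.
theorem pairing_link_sub (x : K) {s : ℕ} (hs : s + 1 ≤ N) :
    pairing x (link f (w s) (w (s + 1))) g ((w '' Set.Iic N) \ {w s, w (s + 1)}) W'
      - pairing x f g ((w '' Set.Iic N) \ {w s, w (s + 1)}) W'
    = if CupAt f g W' w N s then x ^ (loopSet f g).ncard * (x - 1)
      else if (∃ m, m + 1 = s ∧ CupAt f g W' w N m) ∨ (s + 2 ≤ N ∧ CupAt f g W' w N (s + 1))
        then x ^ (loopSet f g).ncard else 0 := by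
  have hf := h.left_inv
  have hg := h.right_inv
  have hi := h.fixed (a := s) (by omega)
  have hj := h.fixed hs
  have hne := h.ne (a := s) (b := s + 1) (by omega) (by omega) hs
  unfold pairing
  rw [h.others_iff hs, h.others_iff hs]
  by_cases hij : Joined f g (w s) (w (s + 1))
  · simp only [joined_link_of_joined hf hg hi hj hij,
      ncard_loopSet_link_of_joined hf hg hi hj hne hij]
    by_cases hA : ∀ c ≤ N, c ≠ s → c ≠ s + 1 → ∃ z ∈ W', Joined f g (w c) z
    · rw [if_pos hA, if_pos hA, if_pos ⟨hij, hA⟩]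
      ring
    · rw [if_neg hA, if_neg hA, if_neg fun h' : CupAt f g W' w N s => hA h'.2, if_neg, sub_zero]
      rintro (⟨m, rfl, h'⟩ | ⟨h₁, h'⟩)
      · exact h.not_right (by omega) hs (by omega) hij.symm
          (h'.2 _ hs (by omega) (by omega))
      · exact h.not_right (by omega) (by omega) hs hij (h'.2 s (by omega) (by omega) (by omega))
  · rw [loopSet_link_of_not_joined hf hg hi hj hne hij, if_neg fun h' : CupAt f g W' w N s => hij h'.1]
    by_cases hA : ∀ c ≤ N, c ≠ s → c ≠ s + 1 → ∃ z ∈ W', Joined f g (w c) z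
    · have hA' : ∀ c ≤ N, c ≠ s → c ≠ s + 1 →
          ∃ z ∈ W', Joined (link f (w s) (w (s + 1))) g (w c) z := by
        intro c h₁ h₂ h₃
        obtain ⟨z, hz, hz'⟩ := hA c h₁ h₂ h₃
        exact ⟨z, hz, hz'.to_link hf hg hi hj⟩
      -- All other marked points reach `W'` already, so cup and bullet give the same value; and a
      -- neighbouring cup would need one of these points as an end.
      rw [if_pos hA, if_pos hA', if_neg, sub_self]
      rintro (⟨m, rfl, h'⟩ | ⟨h₁, h'⟩)
      · exact h.not_right (by omega) (by omega) (by omega) h'.1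
          (hA m (by omega) (by omega) (by omega))
      · exact h.not_right (a := s + 1 + 1) (by omega) (by omega) (by omega) h'.1.symm
          (hA _ (by omega) (by omega) (by omega))
    · rw [if_neg hA, sub_zero]
      suffices key : (∀ c ≤ N, c ≠ s → c ≠ s + 1 →
          ∃ z ∈ W', Joined (link f (w s) (w (s + 1))) g (w c) z) ↔
          (∃ m, m + 1 = s ∧ CupAt f g W' w N m) ∨ (s + 2 ≤ N ∧ CupAt f g W' w N (s + 1)) by
        simp only [key]
      constructor
      · intro hA'
        push Not at hA
        obtain ⟨c, hc, hcs, hcs', hcz⟩ := hA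
        obtain ⟨z, hz, hz'⟩ := hA' c hc hcs hcs'
        rw [joined_link hf hg hi hj] at hz'
        rcases hz' with hz' | ⟨h₁, h₂⟩ | ⟨h₁, h₂⟩
        · exact absurd hz' (hcz z hz)
        · left
          -- If `c` were beyond `s + 1`, the arc from `w s` to `w c` would cut `w (s + 1)` off from
          -- `W'`.
          have hlt : c < s := by
            by_contra hlt
            exact h.between (c := s + 1) (by omega) (by omega) hc h₁.symm ⟨z, hz, h₂⟩
          have hd : ∀ d ≤ N, d ≠ c → d ≠ s → ∃ z ∈ W', Joined f g (w d) z := by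
            intro d hd hdc hds
            by_cases hds' : d = s + 1
            · exact ⟨z, hz, hds' ▸ h₂⟩
            obtain ⟨z', hz', hd'⟩ := hA' d hd hds hds'
            rw [joined_link hf hg hi hj] at hd'
            rcases hd' with hd' | ⟨h₃, -⟩ | ⟨-, h₃⟩
            · exact ⟨z', hz', hd'⟩
            · exact (h.not_three hcs.symm hds.symm hdc.symm (by omega) hc hd
                h₁.symm h₃.symm).elim
            · exact absurd ⟨z', hz', h₃⟩ (h.not_right hcs.symm (by omega) hc h₁.symm)
          -- A marked point strictly between `w c` and `w s` would be trapped under their arc,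
          -- although it reaches `W'` by `hd`.
          have hcs2 : c + 1 = s := by
            by_contra hcs2
            exact h.between (c := c + 1) (by omega) (by omega) (by omega) h₁
              (hd _ (by omega) (by omega) (by omega))
          exact ⟨c, hcs2, by rwa [hcs2], fun d h₃ h₄ h₅ => hd d h₃ h₄ (by omega)⟩
        · right
          have hlt : s + 1 < c := by
            by_contra hlt
            exact h.between (c := s) (by omega) (by omega) hs h₁ ⟨z, hz, h₂⟩
          have hd : ∀ d ≤ N, d ≠ c → d ≠ s + 1 → ∃ z ∈ W', Joined f g (w d) z := by
            intro d hd hdc hds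
            by_cases hds' : d = s
            · exact ⟨z, hz, hds' ▸ h₂⟩
            obtain ⟨z', hz', hd'⟩ := hA' d hd hds' hds
            rw [joined_link hf hg hi hj] at hd'
            rcases hd' with hd' | ⟨-, h₃⟩ | ⟨h₃, -⟩
            · exact ⟨z', hz', hd'⟩
            · exact absurd ⟨z', hz', h₃⟩ (h.not_right hcs'.symm (by omega) hc h₁.symm)
            · exact (h.not_three hcs'.symm hds.symm hdc.symm (by omega) hc hd
                h₁.symm h₃.symm).elim
          have hcs2 : c = s + 2 := by
            by_contra hcs2
            exact h.between (c := s + 2) (by omega) (by omega) hc h₁.symm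
              (hd _ (by omega) (by omega) (by omega))
          subst hcs2
          exact ⟨hc, h₁.symm, fun d h₃ h₄ h₅ => hd d h₃ (by omega) (by omega)⟩
      · rintro (⟨m, rfl, h'⟩ | ⟨h₁, h'⟩) c hc hcs hcs'
        · by_cases hcm : c = m
          · subst hcm
            obtain ⟨z, hz, hz'⟩ := h'.2 (c + 1 + 1) hs (by omega) (by omega)
            exact ⟨z, hz, (joined_link hf hg hi hj).2 (Or.inr (Or.inl ⟨h'.1, hz'⟩))⟩
          · obtain ⟨z, hz, hz'⟩ := h'.2 c hc hcm hcs
            exact ⟨z, hz, hz'.to_link hf hg hi hj⟩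
        · by_cases hcm : c = s + 1 + 1
          · subst hcm
            obtain ⟨z, hz, hz'⟩ := h'.2 s (by omega) (by omega) (by omega)
            exact ⟨z, hz, (joined_link hf hg hi hj).2 (Or.inr (Or.inr ⟨h'.1.symm, hz'⟩))⟩
          · obtain ⟨z, hz, hz'⟩ := h'.2 c hc hcs' hcm
            exact ⟨z, hz, hz'.to_link hf hg hi hj⟩

end Marked

/-! ### The Chebyshev recursion -/

theorem u_zero (y : K) : u 0 y = 1 := by simp [u]

theorem u_one (y : K) : u 1 y = y := by simp [u]

theorem u_add_two (n : ℤ) (y : K) : u (n + 2) y = y * u (n + 1) y - u n y := by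
  simp [u, Polynomial.Chebyshev.S_add_two]

open Classical in
/-- A sequence of values with a single cup at `m`, as modified by the recursion that defines
`bracket`. -/
theorem bracket_recursion {y c : K} {F G : ℕ → K} {r : ℕ}
    (hu : ∀ j : ℕ, 1 ≤ j → j ≤ r → u (j : ℤ) y ≠ 0) {L : ℕ → Prop}
    (hL : ∀ m m', m ≤ r → m' ≤ r → L m → L m' → m = m')
    (hF : ∀ s ≤ r, F s = if L s then c * y
      else if (∃ m, m + 1 = s ∧ L m) ∨ (s + 1 ≤ r ∧ L (s + 1)) then c else 0)
    (h0 : G 0 = F 0)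
    (hG : ∀ s, s + 1 ≤ r → G (s + 1) = F (s + 1) - u (s : ℤ) y / u ((s : ℤ) + 1) y * G s) :
    G r = if L r then c * (u ((r : ℤ) + 1) y / u (r : ℤ) y) else 0 := by
  -- After step `s` there remain the pivot, for a cup at `s`, and the entry `c` above the diagonal,
  -- for a cup at `s + 1`. The latter is absent for `s = r`.
  suffices H : ∀ s ≤ r, G s = if L s then c * (u ((s : ℤ) + 1) y / u (s : ℤ) y)
      else if s + 1 ≤ r ∧ L (s + 1) then c else 0 by
    rw [H r le_rfl]
    simp
  intro s
  induction s with
  | zero =>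
    intro hs
    rw [h0, hF 0 hs]
    simp [u_zero, u_one]
  | succ s ih =>
    intro hs
    have ih := ih (by omega)
    have hus := hu (s + 1) (by omega) hs
    rw [hG s hs, hF _ hs, ih]
    have hpred : (∃ m, m + 1 = s + 1 ∧ L m) ↔ L s := by simp
    rw [hpred]
    push_cast at hus ⊢
    by_cases h₁ : L (s + 1)
    · have h₂ : ¬ L s := fun h => by have := hL _ _ (by omega) hs h h₁; omega
      -- On the diagonal, `c * y - c * u_s / u_{s+1} = c * u_{s+2} / u_{s+1}`.
      have h₃ : u ((s : ℤ) + 1 + 1) y = y * u ((s : ℤ) + 1) y - u s y := by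
        rw [← u_add_two]; ring_nf
      rw [if_pos h₁, if_neg h₂, if_pos ⟨hs, h₁⟩, if_pos h₁, h₃]
      field_simp
    · by_cases h₂ : L s
      · have h₃ : ¬ (s + 1 + 1 ≤ r ∧ L (s + 1 + 1)) := fun h => by
          have := hL _ _ (by omega) h.1 h₂ h.2; omega
        have hs0 : u (s : ℤ) y ≠ 0 := by
          rcases Nat.eq_zero_or_pos s with rfl | h
          · simp [u_zero]
          · exact hu s h (by omega)
        -- The entry below the diagonal is eliminated: `c - (u_s / u_{s+1}) * (c * u_{s+1} / u_s) =
        -- 0`.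
        rw [if_neg h₁, if_pos (Or.inl h₂), if_pos h₂, if_neg h₁, if_neg h₃]
        field_simp
        ring
      · simp only [h₁, h₂, if_false, and_false, mul_zero, sub_zero, false_or]

end Pairing

/-! ### The involution of a sequence of steps -/

section Partner

variable {k : ℕ} {a : Steps k}

theorem sum_Ico_add_sum_Icc (a : Steps k) {i m j : Fin k} (him : i ≤ m) (hmj : m ≤ j) :
    ∑ l ∈ Finset.Ico i m, (a l : ℤ) + ∑ l ∈ Finset.Icc m j, (a l : ℤ)
      = ∑ l ∈ Finset.Icc i j, (a l : ℤ) := by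
  rw [← Finset.sum_union]
  · congr 1
    ext l
    simp only [Finset.mem_union, Finset.mem_Ico, Finset.mem_Icc, Fin.le_def, Fin.lt_def] at *
    omega
  · rw [Finset.disjoint_left]
    intro l
    simp only [Finset.mem_Ico, Finset.mem_Icc, Fin.le_def, Fin.lt_def] at *
    omega

theorem sum_Ico_pos {i m : Fin k} (him : i < m)
    (h : ∀ s, i ≤ s → s < m → 0 < ∑ l ∈ Finset.Icc i s, (a l : ℤ)) :
    0 < ∑ l ∈ Finset.Ico i m, (a l : ℤ) := by
  have hm : (m : ℕ) - 1 < k := by omega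
  have := h ⟨m - 1, hm⟩ (by simp only [Fin.le_def, Fin.lt_def] at *; omega)
    (by simp only [Fin.lt_def] at *; omega)
  convert this using 2
  ext l
  simp only [Finset.mem_Ico, Finset.mem_Icc, Fin.le_def, Fin.lt_def] at *
  omega

theorem Paired.right_unique {i j j' : Fin k} (h : Paired a i j) (h' : Paired a i j') : j = j' := by
  rcases lt_trichotomy j j' with hlt | heq | hlt
  · exact absurd h.2.2.1 (h'.2.2.2 j h.1 hlt)
  · exact heq
  · exact absurd h'.2.2.1 (h.2.2.2 j' h'.1 hlt)

/-- The sum over an edge is zero and its proper initial sums are positive, so its proper final sums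
are negative. -/
theorem Paired.sum_tail_neg {i j m : Fin k} (h : Paired a i j) (him : i < m) (hmj : m ≤ j) :
    ∑ l ∈ Finset.Icc m j, (a l : ℤ) < 0 := by
  have h₁ := sum_Ico_add_sum_Icc a him.le hmj
  have h₂ := sum_Ico_pos him fun s hs hs' => h.sum_pos hs (hs'.trans_le hmj)
  rw [h.2.2.1] at h₁
  omega

theorem Paired.left_unique {i i' j : Fin k} (h : Paired a i j) (h' : Paired a i' j) : i = i' := by
  rcases lt_trichotomy i i' with hlt | heq | hlt
  · exact absurd h'.2.2.1 (h.sum_tail_neg hlt h'.1.le).ne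
  · exact heq
  · exact absurd h.2.2.1 (h'.sum_tail_neg hlt h.1.le).ne

theorem Paired.not_paired_left {i j l : Fin k} (h : Paired a i j) : ¬ Paired a j l := fun h' => by
  have := h'.2.1
  rw [h.right_eq] at this
  exact absurd this (by decide)

/-- If the edges crossed, the sum from `i'` to `j` would be positive as an initial sum of one and
negative as a final sum of the other. -/
theorem Paired.lt_of_lt {i j i' j' : Fin k} (h : Paired a i j) (h' : Paired a i' j')
    (h₁ : i < i') (h₂ : i' < j) : j' < j := by
  rcases lt_trichotomy j j' with hlt | heq | hlt
  · exact absurd (h'.sum_pos h₂.le hlt) (h.sum_tail_neg h₁ h₂.le).not_gt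
  · exact absurd (h.left_unique (heq ▸ h')) h₁.ne
  · exact hlt

theorem White.not_between {i j w : Fin k} (hw : White a w) (h : Paired a i j) (h₁ : i ≤ w)
    (h₂ : w ≤ j) : False := by
  rcases h₁.eq_or_lt with rfl | h₁
  · exact hw.2 j h
  · exact absurd (hw.sum_pos h₂) (h.sum_tail_neg h₁ h₂).not_gt

open Classical in
/-- The vertex paired with `i`, or `i` itself if it is not paired. -/
noncomputable def partner (a : Steps k) (i : Fin k) : Fin k :=
  if h : ∃ j, Paired a i j then h.choose else if h : ∃ j, Paired a j i then h.choose else i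

theorem Paired.partner_left {i j : Fin k} (h : Paired a i j) : partner a i = j := by
  have hex : ∃ j, Paired a i j := ⟨j, h⟩
  rw [partner, dif_pos hex]
  exact hex.choose_spec.right_unique h

theorem Paired.partner_right {i j : Fin k} (h : Paired a i j) : partner a j = i := by
  have hex : ∃ i, Paired a i j := ⟨i, h⟩
  rw [partner, dif_neg fun h' => h.not_paired_left h'.choose_spec, dif_pos hex]
  exact hex.choose_spec.left_unique h

theorem partner_cases (a : Steps k) (i : Fin k) :
    Paired a i (partner a i) ∨ Paired a (partner a i) i ∨
      partner a i = i ∧ ∀ j, ¬ Paired a i j ∧ ¬ Paired a j i := by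
  by_cases h₁ : ∃ j, Paired a i j
  · obtain ⟨j, hj⟩ := h₁
    rw [hj.partner_left]
    exact Or.inl hj
  by_cases h₂ : ∃ j, Paired a j i
  · obtain ⟨j, hj⟩ := h₂
    rw [hj.partner_right]
    exact Or.inr (Or.inl hj)
  rw [partner, dif_neg h₁, dif_neg h₂]
  exact Or.inr (Or.inr ⟨rfl, fun j => ⟨fun h => h₁ ⟨j, h⟩, fun h => h₂ ⟨j, h⟩⟩⟩)

theorem partner_involutive (a : Steps k) : (partner a).Involutive := by
  intro i
  rcases partner_cases a i with h | h | ⟨h, -⟩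
  · exact h.partner_right
  · exact h.partner_left
  · rw [h, h]

theorem paired_partner {i : Fin k} (h : i < partner a i) : Paired a i (partner a i) := by
  rcases partner_cases a i with h' | h' | ⟨h', -⟩
  · exact h'
  · exact absurd h'.1 h.not_gt
  · exact absurd h' h.ne'

theorem partner_eq_self_iff {i : Fin k} :
    partner a i = i ↔ ∀ j, ¬ Paired a i j ∧ ¬ Paired a j i := by
  constructor
  · intro h j
    exact ⟨fun h' => h'.1.ne' (h'.partner_left.symm.trans h),
      fun h' => h'.1.ne (h'.partner_right.symm.trans h)⟩
  · intro h
    rcases partner_cases a i with h' | h' | ⟨h', -⟩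
    · exact absurd h' (h _).1
    · exact absurd h' (h _).2
    · exact h'

theorem noncrossing_partner (a : Steps k) : Noncrossing (partner a) := by
  intro u v huv hv
  have h := paired_partner (huv.trans hv)
  rcases partner_cases a v with h' | h' | ⟨h', -⟩
  · exact ⟨huv.trans h'.1, h.lt_of_lt h' huv hv⟩
  · refine ⟨?_, h'.1.trans hv⟩
    rcases lt_trichotomy u (partner a v) with hlt | heq | hlt
    · exact hlt
    · rw [← heq] at h'
      exact absurd (h.right_unique h') hv.ne'
    · exact absurd (h'.lt_of_lt h hlt huv) hv.not_gt
  · rw [h']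
    exact ⟨huv, hv⟩

theorem White.partner_eq {w : Fin k} (hw : White a w) : partner a w = w :=
  partner_eq_self_iff.2 fun j => ⟨hw.2 j, fun h => hw.not_between h h.1.le le_rfl⟩

theorem White.exposed {w : Fin k} (hw : White a w) : Exposed (partner a) w :=
  ⟨hw.partner_eq, fun _ h₁ h₂ => hw.not_between (paired_partner (h₁.trans h₂)) h₁.le h₂.le⟩

end Partner

/-! ### Sequences with nonnegative partial sums, and cups on consecutive white vertices -/

section Nonneg

variable {k : ℕ} {a : Steps k} (ha : ∀ s : Fin k, 0 ≤ ∑ i ∈ Finset.Iic s, (a i : ℤ))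

include ha

/-- If the partial sums are nonnegative, then every entry `-1` is paired. -/
theorem exists_paired_right {j : Fin k} (hj : a j = -1) : ∃ i, Paired a i j := by
  have h0 : 0 < k := j.pos
  let T : Fin k → ℤ := fun i => ∑ l ∈ Finset.Icc i j, (a l : ℤ)
  -- The left end is the largest index from which the sum up to `j` is still nonnegative; the first
  -- vertex is a candidate by `ha`.
  let S : Finset (Fin k) := (Finset.Iic j).filter fun i => 0 ≤ T i
  have hS : S.Nonempty := by
    refine ⟨⟨0, h0⟩, ?_⟩
    simp only [S, Finset.mem_filter, Finset.mem_Iic, Fin.le_def]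
    refine ⟨Nat.zero_le _, ?_⟩
    have hIcc : Finset.Icc (⟨0, h0⟩ : Fin k) j = Finset.Iic j := by
      ext l
      simp only [Finset.mem_Icc, Finset.mem_Iic, Fin.le_def]
      omega
    simp only [T, hIcc]
    exact ha j
  obtain ⟨i, hiS, hmax⟩ := S.exists_max_image id hS
  simp only [S, Finset.mem_filter, Finset.mem_Iic, id] at hiS hmax
  have hneg : ∀ t, i < t → t ≤ j → T t < 0 := by
    intro t ht htj
    by_contra hcon
    exact absurd (hmax t ⟨htj, not_lt.1 hcon⟩) (not_le.mpr ht)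
  have hij : i < j := by
    refine lt_of_le_of_ne hiS.1 ?_
    rintro rfl
    have := hiS.2
    simp [T, hj] at this
  have hsplit : ∀ m, i ≤ m → m < j → ∃ t, m < t ∧ t ≤ j ∧
      ∑ l ∈ Finset.Icc i m, (a l : ℤ) + T t = T i := by
    intro m him hmj
    have hm : (m : ℕ) + 1 < k := by simp only [Fin.lt_def] at hmj; omega
    refine ⟨⟨m + 1, hm⟩, by simp [Fin.lt_def], by simpa [Fin.le_def] using hmj, ?_⟩
    simp only [T]
    rw [← sum_Ico_add_sum_Icc a (i := i) (m := ⟨m + 1, hm⟩) (j := j)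
      (by simp only [Fin.le_def] at *; omega) (by simpa [Fin.le_def] using hmj)]
    congr 2
  obtain ⟨t, h₁, h₂, h₃⟩ := hsplit i le_rfl hij
  have h₄ := hneg t h₁ h₂
  have h₅ := hiS.2
  simp only [Finset.Icc_self, Finset.sum_singleton] at h₃
  have hai : a i = 1 := by
    cases hc : a i
    · simp [hc] at h₃; omega
    · simp [hc] at h₃; omega
    · rfl
  refine ⟨i, hij, hai, ?_, fun m him hmj => ?_⟩
  · simp [hai] at h₃
    change T i = 0
    omega
  · obtain ⟨t, h₆, h₇, h₈⟩ := hsplit m him.le hmj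
    have := hneg t (him.trans h₆) h₇
    omega

theorem eq_zero_or_white {i : Fin k} (hi : partner a i = i) : a i = 0 ∨ White a i := by
  rw [partner_eq_self_iff] at hi
  cases hc : a i
  · exact Or.inl rfl
  · obtain ⟨j, hj⟩ := exists_paired_right ha hc
    exact absurd hj (hi j).2
  · exact Or.inr ⟨hc, fun j => (hi j).1⟩

open Classical in
-- The two entries of an edge cancel, and an unpaired entry is 0 or a white 1.
theorem sum_eq_card_white {S : Finset (Fin k)} (hS : ∀ i ∈ S, partner a i ∈ S) :
    ∑ i ∈ S, (a i : ℤ) = ((S.filter fun i => White a i).card : ℤ) := by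
  rw [← Finset.sum_filter_not_add_sum_filter S (fun i => partner a i = i)]
  have h₁ : ∑ i ∈ S.filter (fun i => ¬ partner a i = i), (a i : ℤ) = 0 := by
    refine Finset.sum_involution (fun i _ => partner a i) ?_ ?_ ?_ ?_
    · intro i hi
      rcases partner_cases a i with h | h | ⟨h, -⟩
      · rw [h.right_eq, h.2.1]; simp
      · rw [h.right_eq, h.2.1]; simp
      · exact absurd h (Finset.mem_filter.1 hi).2
    · intro i hi _
      exact (Finset.mem_filter.1 hi).2
    · intro i hi
      rw [Finset.mem_filter] at hi ⊢
      exact ⟨hS i hi.1, fun h => hi.2 ((partner_involutive a).injective h)⟩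
    · intro i _
      exact partner_involutive a i
  rw [h₁, zero_add, Finset.card_filter, Nat.cast_sum, Finset.sum_filter]
  refine Finset.sum_congr rfl fun i _ => ?_
  by_cases hi : partner a i = i
  · rcases eq_zero_or_white ha hi with h | h
    · have : ¬ White a i := fun h' => by rw [h'.1] at h; exact absurd h (by decide)
      simp [hi, h, this]
    · simp [hi, h, h.1]
  · have : ¬ White a i := fun h' => hi h'.partner_eq
    simp [hi, this]

variable {i j : Fin k} (hij : i < j) (hi : White a i) (hj : White a j)
  {b : Steps k} (hb : ∀ l, l ≠ i → l ≠ j → b l = a l)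

omit ha in
include hi hj hb in
-- No white vertex lies at or below an edge, so altering `a` at white vertices leaves the sums that
-- define its edges unchanged.
theorem Paired.of_eq_off {u v : Fin k} (h : Paired a u v) : Paired b u v := by
  have hne : ∀ l, u ≤ l → l ≤ v → b l = a l := fun l h₁ h₂ =>
    hb l (fun h' => hi.not_between h (h' ▸ h₁) (h' ▸ h₂))
      fun h' => hj.not_between h (h' ▸ h₁) (h' ▸ h₂)
  have hsum : ∀ m ≤ v, ∑ l ∈ Finset.Icc u m, (b l : ℤ) = ∑ l ∈ Finset.Icc u m, (a l : ℤ) :=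
    fun m hm => Finset.sum_congr rfl fun l hl => by
      rw [Finset.mem_Icc] at hl
      rw [hne l hl.1 (hl.2.trans hm)]
  refine ⟨h.1, by rw [hne u le_rfl h.1.le, h.2.1], by rw [hsum v le_rfl, h.2.2.1], ?_⟩
  intro m h₁ h₂
  rw [hsum m h₂.le]
  exact h.2.2.2 m h₁ h₂

include hi hj hb in
-- An edge of `b` ends in a -1, which is also a -1 of `a` and hence already paired there; that old
-- edge persists in `b`, so the two coincide. The same argument recurs for a cup.
theorem paired_iff_of_zero (hbi : b i = 0) (hbj : b j = 0) {u v : Fin k} :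
    Paired b u v ↔ Paired a u v := by
  refine ⟨fun h => ?_, fun h => h.of_eq_off hi hj hb⟩
  have hv := h.right_eq
  have hvi : v ≠ i := by rintro rfl; rw [hbi] at hv; exact absurd hv (by decide)
  have hvj : v ≠ j := by rintro rfl; rw [hbj] at hv; exact absurd hv (by decide)
  rw [hb v hvi hvj] at hv
  obtain ⟨u', hu'⟩ := exists_paired_right ha hv
  rwa [h.left_unique (hu'.of_eq_off hi hj hb)]

include hij hi hj hb in
theorem paired_iff_of_cup (hcons : ∀ l, i < l → l < j → ¬ White a l) (hbi : b i = 1)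
    (hbj : b j = -1) {u v : Fin k} : Paired b u v ↔ Paired a u v ∨ u = i ∧ v = j := by
  classical
  have hnew : Paired b i j := by
    have hsum : ∀ m, i ≤ m → m < j → ∑ l ∈ Finset.Icc i m, (b l : ℤ)
        = ∑ l ∈ Finset.Icc i m, (a l : ℤ) := fun m _ hm => Finset.sum_congr rfl fun l hl => by
      rw [Finset.mem_Icc] at hl
      by_cases hli : l = i
      · rw [hli, hbi, hi.1]
      · rw [hb l hli (hl.2.trans_lt hm).ne]
    refine ⟨hij, hbi, ?_, fun m h₁ h₂ => ?_⟩
    · have hIoo : ∑ l ∈ Finset.Ioo i j, (b l : ℤ) = 0 := by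
        have : ∑ l ∈ Finset.Ioo i j, (b l : ℤ) = ∑ l ∈ Finset.Ioo i j, (a l : ℤ) :=
          Finset.sum_congr rfl fun l hl => by
            rw [Finset.mem_Ioo] at hl
            rw [hb l hl.1.ne' hl.2.ne]
        rw [this, sum_eq_card_white ha]
        · rw [Nat.cast_eq_zero, Finset.card_eq_zero, Finset.filter_eq_empty_iff]
          intro l hl
          rw [Finset.mem_Ioo] at hl
          exact hcons l hl.1 hl.2
        · intro l hl
          rw [Finset.mem_Ioo] at hl ⊢
          rcases partner_cases a l with h | h | ⟨h, -⟩
          · refine ⟨hl.1.trans h.1, lt_of_not_ge fun h' => ?_⟩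
            exact hj.not_between h hl.2.le h'
          · refine ⟨lt_of_not_ge fun h' => ?_, h.1.trans hl.2⟩
            exact hi.not_between h h' hl.1.le
          · rw [h]; exact hl
      have hins : Finset.Icc i j = insert i (insert j (Finset.Ioo i j)) := by
        ext l
        simp only [Finset.mem_Icc, Finset.mem_insert, Finset.mem_Ioo, Fin.le_def, Fin.lt_def,
          Fin.ext_iff] at *
        omega
      rw [hins, Finset.sum_insert, Finset.sum_insert, hIoo, hbi, hbj]
      · simp
      · simp
      · simp [hij.ne]
    · rw [hsum m h₁.le h₂]
      exact (hi.sum_pos h₁.le).ne'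
  constructor
  · intro h
    have hv := h.right_eq
    by_cases hvj : v = j
    · subst hvj
      exact Or.inr ⟨h.left_unique hnew, rfl⟩
    have hvi : v ≠ i := by rintro rfl; rw [hbi] at hv; exact absurd hv (by decide)
    rw [hb v hvi hvj] at hv
    obtain ⟨u', hu'⟩ := exists_paired_right ha hv
    left
    rwa [h.left_unique (hu'.of_eq_off hi hj hb)]
  · rintro (h | ⟨rfl, rfl⟩)
    · exact h.of_eq_off hi hj hb
    · exact hnew

include hi hj hb in
theorem partner_of_zero (hbi : b i = 0) (hbj : b j = 0) : partner b = partner a := by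
  have h := fun u v => paired_iff_of_zero ha hi hj hb hbi hbj (u := u) (v := v)
  funext v
  rcases partner_cases a v with h' | h' | ⟨h', h''⟩
  · exact ((h _ _).2 h').partner_left
  · exact ((h _ _).2 h').partner_right
  · rw [h', partner_eq_self_iff]
    simpa only [h] using h''

include hi hj hb in
theorem white_of_zero (hbi : b i = 0) (hbj : b j = 0) {l : Fin k} :
    White b l ↔ White a l ∧ l ≠ i ∧ l ≠ j := by
  have h := fun u v => paired_iff_of_zero ha hi hj hb hbi hbj (u := u) (v := v)
  simp only [White, h]
  by_cases h₁ : l = i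
  · simp [h₁, hbi]
  by_cases h₂ : l = j
  · simp [h₂, hbj]
  simp [h₁, h₂, hb l h₁ h₂]

include hij hi hj hb in
theorem partner_of_cup (hcons : ∀ l, i < l → l < j → ¬ White a l) (hbi : b i = 1)
    (hbj : b j = -1) : partner b = link (partner a) i j := by
  have h := fun u v => paired_iff_of_cup ha hij hi hj hb hcons hbi hbj (u := u) (v := v)
  funext v
  by_cases h₁ : v = i
  · rw [h₁, link_left]
    exact ((h _ _).2 (Or.inr ⟨rfl, rfl⟩)).partner_left
  by_cases h₂ : v = j
  · rw [h₂, link_right]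
    exact ((h _ _).2 (Or.inr ⟨rfl, rfl⟩)).partner_right
  rw [link_of_ne _ h₁ h₂]
  rcases partner_cases a v with h' | h' | ⟨h', h''⟩
  · exact ((h _ _).2 (Or.inl h')).partner_left
  · exact ((h _ _).2 (Or.inl h')).partner_right
  · rw [h', partner_eq_self_iff]
    simpa only [h, h₁, h₂, false_and, and_false, or_false] using h''

include hij hi hj hb in
theorem white_of_cup (hcons : ∀ l, i < l → l < j → ¬ White a l) (hbi : b i = 1)
    (hbj : b j = -1) {l : Fin k} : White b l ↔ White a l ∧ l ≠ i ∧ l ≠ j := by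
  have h := fun u v => paired_iff_of_cup ha hij hi hj hb hcons hbi hbj (u := u) (v := v)
  simp only [White, h]
  by_cases h₁ : l = i
  · subst h₁
    simp only [ne_eq, not_true_eq_false, false_and, and_false, iff_false, not_and, not_forall]
    exact fun _ => ⟨j, fun h' => h' (Or.inr ⟨trivial, rfl⟩)⟩
  by_cases h₂ : l = j
  · simp [h₂, hbj]
  simp [h₁, h₂, hb l h₁ h₂]

end Nonneg

/-- The set of white vertices. -/
def whites {k : ℕ} (a : Steps k) : Set (Fin k) := {i | White a i}

theorem ncard_whites {k : ℕ} {a : Steps k} {r : ℤ} (ha : IsPath r a) :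
    ((whites a).ncard : ℤ) = r := by
  classical
  rw [← ha.2, sum_eq_card_white ha.1 (by simp), whites, ← Set.ncard_coe_finset]
  simp

/-! ### The Gram matrix in terms of meanders -/

section Gram

variable {k : ℕ}

/-- This forces the vertical edges of `diagram a a` to join each white vertex to its own copy. -/
theorem White.eq_of_ncard_eq {a : Steps k} {i j : Fin k} (hi : White a i) (hj : White a j)
    (h : {l | l < i ∧ White a l}.ncard = {l | l < j ∧ White a l}.ncard) : i = j := by
  have key : ∀ i j : Fin k, White a i → i < j →
      {l | l < i ∧ White a l}.ncard < {l | l < j ∧ White a l}.ncard := by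
    intro i j hi hij
    refine Set.ncard_lt_ncard ⟨fun l hl => ⟨hl.1.trans hij, hl.2⟩, fun hsub => ?_⟩
      (Set.toFinite _)
    exact lt_irrefl i (hsub (show i ∈ {l | l < j ∧ White a l} from ⟨hij, hi⟩)).1
  rcases lt_trichotomy i j with hlt | heq | hlt
  · exact absurd h (key i j hi hlt).ne
  · exact heq
  · exact absurd h (key j i hj hlt).ne'

theorem adj_partner_iff {a : Steps k} {i j : Fin k} :
    i ≠ j ∧ (Paired a i j ∨ Paired a j i) ↔ partner a i ≠ i ∧ j = partner a i := by
  constructor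
  · rintro ⟨hne, h | h⟩
    · rw [h.partner_left]; exact ⟨hne.symm, rfl⟩
    · rw [h.partner_right]; exact ⟨hne.symm, rfl⟩
  · rintro ⟨hne, rfl⟩
    refine ⟨hne.symm, ?_⟩
    rcases partner_cases a i with h | h | ⟨h, -⟩
    · exact Or.inl h
    · exact Or.inr h
    · exact absurd h hne

theorem diagram_adj_inl_inl {a : Steps k} {i j : Fin k} :
    (diagram a a).Adj (Sum.inl i) (Sum.inl j) ↔ partner a i ≠ i ∧ j = partner a i := by
  rw [← adj_partner_iff]
  simp [diagram]

theorem diagram_adj_inr_inr {a : Steps k} {i j : Fin k} :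
    (diagram a a).Adj (Sum.inr i) (Sum.inr j) ↔ partner a i ≠ i ∧ j = partner a i := by
  rw [← adj_partner_iff]
  simp [diagram]

theorem diagram_adj_inl_inr {a : Steps k} {i j : Fin k} :
    (diagram a a).Adj (Sum.inl i) (Sum.inr j) ↔ White a i ∧ j = i := by
  simp only [diagram, SimpleGraph.fromRel_adj, or_false]
  constructor
  · rintro ⟨-, hi, hj, h⟩
    exact ⟨hi, (hi.eq_of_ncard_eq hj h).symm⟩
  · rintro ⟨hi, rfl⟩
    exact ⟨by simp, hi, hi, rfl⟩

theorem diagram_adj_inr_inl {a : Steps k} {i j : Fin k} :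
    (diagram a a).Adj (Sum.inr i) (Sum.inl j) ↔ White a i ∧ j = i := by
  rw [SimpleGraph.adj_comm, diagram_adj_inl_inr]
  constructor
  · rintro ⟨h, rfl⟩; exact ⟨h, rfl⟩
  · rintro ⟨h, rfl⟩; exact ⟨h, rfl⟩

variable (p q : Steps k)

/-- The stack of the diagrams of `p` and `q`. -/
abbrev tower : SimpleGraph (Fin k ⊕ (Fin k ⊕ Fin k)) := stack (diagram p p) (diagram q q)

theorem upper_adj_iff {a : Steps k} {v w : Fin k ⊕ (Fin k ⊕ Fin k)} :
    (upper (diagram a a)).Adj v w ↔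
      match v, w with
      | Sum.inl i, Sum.inl j => partner a i ≠ i ∧ j = partner a i
      | Sum.inr (Sum.inl i), Sum.inr (Sum.inl j) => partner a i ≠ i ∧ j = partner a i
      | Sum.inl i, Sum.inr (Sum.inl j) => White a i ∧ j = i
      | Sum.inr (Sum.inl i), Sum.inl j => White a i ∧ j = i
      | _, _ => False := by
  rcases v with i | i | i <;> rcases w with j | j | j <;>
  simp [upper, SimpleGraph.map_adj', diagram_adj_inl_inl, diagram_adj_inr_inr,
    diagram_adj_inl_inr, diagram_adj_inr_inl]
  all_goals
    rintro h rfl h'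
    exact h h'.symm

theorem lower_adj_iff {a : Steps k} {v w : Fin k ⊕ (Fin k ⊕ Fin k)} :
    (lower (diagram a a)).Adj v w ↔
      match v, w with
      | Sum.inr (Sum.inl i), Sum.inr (Sum.inl j) => partner a i ≠ i ∧ j = partner a i
      | Sum.inr (Sum.inr i), Sum.inr (Sum.inr j) => partner a i ≠ i ∧ j = partner a i
      | Sum.inr (Sum.inl i), Sum.inr (Sum.inr j) => White a i ∧ j = i
      | Sum.inr (Sum.inr i), Sum.inr (Sum.inl j) => White a i ∧ j = i
      | _, _ => False := by
  rcases v with i | i | i <;> rcases w with j | j | j <;>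
  simp [lower, SimpleGraph.map_adj', diagram_adj_inl_inl, diagram_adj_inr_inr,
    diagram_adj_inl_inr, diagram_adj_inr_inl]
  all_goals
    rintro h rfl h'
    exact h h'.symm

variable {p q}

theorem reachable_induction {W : Type*} {G : SimpleGraph W} {P : W → Prop}
    (hP : ∀ v w, G.Adj v w → P v → P w) {v w : W} (h : G.Reachable v w) (hv : P v) : P w := by
  obtain ⟨c⟩ := h
  induction c with
  | nil => exact hv
  | cons hadj _ ih => exact ih (hP _ _ hadj hv)

/-- The vertices of the three rows that lie in the component of the middle vertex `i`. -/
def Tracked (p q : Steps k) (i : Fin k) : Fin k ⊕ (Fin k ⊕ Fin k) → Prop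
  | Sum.inl l => White p l ∧ Joined (partner p) (partner q) i l
  | Sum.inr (Sum.inl l) => Joined (partner p) (partner q) i l
  | Sum.inr (Sum.inr l) => White q l ∧ Joined (partner p) (partner q) i l

theorem tracked_of_reachable {i : Fin k} {v : Fin k ⊕ (Fin k ⊕ Fin k)}
    (h : (tower p q).Reachable (Sum.inr (Sum.inl i)) v) : Tracked p q i v := by
  refine reachable_induction (P := Tracked p q i) ?_ h (Joined.refl _ _ _)
  rintro v w (hadj | hadj) hv
  · rw [upper_adj_iff] at hadj
    rcases v with v | v | v <;> rcases w with w | w | w <;> simp only [Tracked] at hadj hv ⊢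
    · exact absurd hv.1.partner_eq hadj.1
    · rw [hadj.2]; exact hv.2
    · rw [hadj.2]; exact ⟨hadj.1, hv⟩
    · rw [hadj.2]; exact hv.step_left
  · rw [lower_adj_iff] at hadj
    rcases v with v | v | v <;> rcases w with w | w | w <;> simp only [Tracked] at hadj hv ⊢
    · rw [hadj.2]; exact hv.step_right
    · rw [hadj.2]; exact ⟨hadj.1, hv⟩
    · rw [hadj.2]; exact hv.2
    · exact absurd hv.1.partner_eq hadj.1

theorem reachable_middle {i j : Fin k} :
    (tower p q).Reachable (Sum.inr (Sum.inl i)) (Sum.inr (Sum.inl j)) ↔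
      Joined (partner p) (partner q) i j := by
  refine ⟨tracked_of_reachable, fun h => ?_⟩
  refine Joined.induction (partner_involutive p) (partner_involutive q)
    (P := fun j => (tower p q).Reachable (Sum.inr (Sum.inl i)) (Sum.inr (Sum.inl j)))
    (fun v hv => ?_) (fun v hv => ?_) h (SimpleGraph.Reachable.refl _)
  · by_cases hne : partner p v = v
    · rwa [hne]
    · exact hv.trans (SimpleGraph.Adj.reachable (Or.inl (upper_adj_iff.2 ⟨hne, rfl⟩)))
  · by_cases hne : partner q v = v
    · rwa [hne]
    · exact hv.trans (SimpleGraph.Adj.reachable (Or.inr (lower_adj_iff.2 ⟨hne, rfl⟩)))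

theorem reachable_top_bottom {i j : Fin k} :
    (tower p q).Reachable (Sum.inl i) (Sum.inr (Sum.inr j)) ↔
      White p i ∧ White q j ∧ Joined (partner p) (partner q) i j := by
  have htop : White p i → (tower p q).Reachable (Sum.inl i) (Sum.inr (Sum.inl i)) := fun hi =>
    SimpleGraph.Adj.reachable (Or.inl (upper_adj_iff.2 ⟨hi, rfl⟩))
  constructor
  · intro h
    by_cases hi : White p i
    · exact ⟨hi, tracked_of_reachable ((htop hi).symm.trans h)⟩
    -- A top vertex that is not white meets only edges of the top row, and these lead to vertices
    -- that are not white.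
    · have := reachable_induction (P := fun v => ∃ l, v = Sum.inl l ∧ ¬ White p l) ?_ h
        ⟨i, rfl, hi⟩
      · obtain ⟨l, hl, -⟩ := this
        cases hl
      · rintro _ w (hadj | hadj) ⟨l, rfl, hl⟩
        · rw [upper_adj_iff] at hadj
          rcases w with w | w | w <;> simp only at hadj
          · refine ⟨w, rfl, fun hw => hadj.1 ?_⟩
            have := hw.partner_eq
            rw [hadj.2, partner_involutive p l] at this
            exact this.symm
          · exact absurd hadj.1 hl
        · rw [lower_adj_iff] at hadj
          exact hadj.elim
  · rintro ⟨hi, hj, h⟩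
    exact (htop hi).trans ((reachable_middle.2 h).trans
      (SimpleGraph.Adj.reachable (Or.inr (lower_adj_iff.2 ⟨hj, rfl⟩))))

/-- A vertex of an outer row carries edges of only one of the diagrams, so a loop lies in the middle
row and is determined by its trace there. It contains no white vertex of `p` or `q`, since that
would connect it to an outer row. -/
theorem loops_eq_ncard_loopSet :
    loops (diagram p p) (diagram q q) = (loopSet (partner p) (partner q)).ncard := by
  let Φ : (tower p q).ConnectedComponent → Set (Fin k) :=
    fun c => {l | Sum.inr (Sum.inl l) ∈ c.supp}
  have hΦ : ∀ i, Φ ((tower p q).connectedComponentMk (Sum.inr (Sum.inl i)))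
      = {l | Joined (partner p) (partner q) i l} := by
    intro i
    ext l
    change (tower p q).connectedComponentMk _ = (tower p q).connectedComponentMk _ ↔ _
    rw [SimpleGraph.ConnectedComponent.eq, SimpleGraph.reachable_comm]
    exact reachable_middle
  have hmid : ∀ c : (tower p q).ConnectedComponent,
      (∀ v ∈ c.supp, (∃ w, (upper (diagram p p)).Adj v w) ∧
        ∃ w, (lower (diagram q q)).Adj v w) →
      ∃ i, c = (tower p q).connectedComponentMk (Sum.inr (Sum.inl i)) := by
    intro c hc
    induction c using SimpleGraph.ConnectedComponent.ind with
    | h v =>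
      obtain ⟨⟨w, hw⟩, z, hz⟩ := hc v rfl
      rw [upper_adj_iff] at hw
      rw [lower_adj_iff] at hz
      rcases v with v | v | v
      · exact hz.elim
      · exact ⟨v, rfl⟩
      · exact hw.elim
  unfold loops
  rw [← Set.InjOn.ncard_image (f := Φ)]
  · congr 1
    ext S
    constructor
    · rintro ⟨c, hc, rfl⟩
      obtain ⟨i, rfl⟩ := hmid c hc
      refine ⟨i, hΦ i, fun l hl => ?_⟩
      obtain ⟨⟨w, hw⟩, z, hz⟩ := hc _ hl
      have hup := hw
      have hlow := hz
      rw [upper_adj_iff] at hw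
      rw [lower_adj_iff] at hz
      constructor
      · rcases w with w | w | w <;> simp only at hw
        · have hmem : (Sum.inl w) ∈ ((tower p q).connectedComponentMk
              (Sum.inr (Sum.inl i))).supp :=
            (SimpleGraph.ConnectedComponent.sound
              (SimpleGraph.Adj.reachable (Or.inl hup))).symm.trans hl
          obtain ⟨-, y, hy⟩ := hc _ hmem
          rw [lower_adj_iff] at hy
          exact hy.elim
        · exact hw.1
      · rcases z with z | z | z <;> simp only at hz
        · exact hz.1
        · have hmem : (Sum.inr (Sum.inr z)) ∈ ((tower p q).connectedComponentMk
              (Sum.inr (Sum.inl i))).supp :=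
            (SimpleGraph.ConnectedComponent.sound
              (SimpleGraph.Adj.reachable (Or.inr hlow))).symm.trans hl
          obtain ⟨⟨y, hy⟩, -⟩ := hc _ hmem
          rw [upper_adj_iff] at hy
          exact hy.elim
    · rintro ⟨i, rfl, h⟩
      refine ⟨_, ?_, hΦ i⟩
      intro v hv
      have hreach := tracked_of_reachable (SimpleGraph.ConnectedComponent.exact hv).symm
      rcases v with v | v | v <;> simp only [Tracked] at hreach
      · exact absurd hreach.1.partner_eq (h v hreach.2).1
      · exact ⟨⟨Sum.inr (Sum.inl (partner p v)), upper_adj_iff.2 ⟨(h v hreach).1, rfl⟩⟩,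
          ⟨Sum.inr (Sum.inl (partner q v)), lower_adj_iff.2 ⟨(h v hreach).2, rfl⟩⟩⟩
      · exact absurd hreach.1.partner_eq (h v hreach.2).2
  · intro c hc c' hc' heq
    obtain ⟨i, rfl⟩ := hmid c hc
    have : i ∈ Φ c' := by
      rw [← heq]
      rfl
    exact this

/-- An arc has at most two ends, so the upper end of a vertical edge determines the lower one. -/
theorem rank_comp :
    rank (comp (diagram p p) (diagram q q))
      = {i | White p i ∧ ∃ j, White q j ∧ Joined (partner p) (partner q) i j}.ncard := by
  unfold rank
  symm
  have hset : {i | White p i ∧ ∃ j, White q j ∧ Joined (partner p) (partner q) i j}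
      = Prod.fst '' {e : Fin k × Fin k | (comp (diagram p p) (diagram q q)).Adj
          (Sum.inl e.1) (Sum.inr e.2)} := by
    ext i
    constructor
    · rintro ⟨hi, j, hj, h⟩
      exact ⟨(i, j), ⟨by simp, reachable_top_bottom.2 ⟨hi, hj, h⟩⟩, rfl⟩
    · rintro ⟨⟨i, j⟩, ⟨-, h⟩, rfl⟩
      obtain ⟨hi, hj, h⟩ := reachable_top_bottom.1 h
      exact ⟨hi, j, hj, h⟩
  rw [hset]
  refine Set.InjOn.ncard_image ?_
  rintro ⟨i, j⟩ ⟨-, h⟩ ⟨i', j'⟩ ⟨-, h'⟩ (rfl : i = i')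
  obtain ⟨hi, hj, h⟩ := reachable_top_bottom.1 h
  obtain ⟨-, hj', h'⟩ := reachable_top_bottom.1 h'
  exact Prod.ext rfl (eq_of_joined_right_fixed (partner_involutive p) (partner_involutive q)
    hi.partner_eq hj.partner_eq hj'.partner_eq h h')

/-- Exactly `r` vertices of `p` are white, so the product has rank less than `r` precisely when one
of them fails to reach a white vertex of `q`. -/
theorem gram_eq_pairing {K : Type*} [Field K] (x : K) {r : ℤ} (p q : Path k r) :
    gram x k r p q = pairing x (partner p.1) (partner q.1) (whites p.1) (whites q.1) := by
  simp only [gram, Matrix.of_apply, pairing, loops_eq_ncard_loopSet, rank_comp]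
  have hcard := ncard_whites p.2
  have hsub : {i | White p.1 i ∧ ∃ j, White q.1 j ∧ Joined (partner p.1) (partner q.1) i j}
      ⊆ whites p.1 := fun i hi => hi.1
  by_cases h : ∀ v ∈ whites p.1, ∃ w ∈ whites q.1, Joined (partner p.1) (partner q.1) v w
  · rw [if_pos h, if_neg]
    rw [Set.Subset.antisymm hsub fun i hi => ⟨hi, h i hi⟩, hcard]
    exact lt_irrefl r
  · rw [if_neg h, if_pos]
    refine lt_of_lt_of_eq (Nat.cast_lt.2 (Set.ncard_lt_ncard
      ⟨hsub, fun hsup => h fun v hv => ?_⟩ (Set.toFinite _))) hcard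
    exact (hsup hv).2

theorem ncard_whites_eq {r : ℤ} (p q : Path k r) : (whites p.1).ncard = (whites q.1).ncard := by
  have h₁ := ncard_whites p.2
  have h₂ := ncard_whites q.2
  omega

/-- If all of the white vertices of `p` are joined to white vertices of `q`, then conversely. -/
theorem joined_whites_surj {a b : Steps k} (hcard : (whites b).ncard ≤ (whites a).ncard)
    (h : ∀ v ∈ whites a, ∃ w ∈ whites b, Joined (partner a) (partner b) v w) :
    ∀ w ∈ whites b, ∃ v ∈ whites a, Joined (partner a) (partner b) v w := by
  choose! F hF hFj using h
  -- Two white vertices of `a` on the arc of one white vertex of `b` would give that arc three ends.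
  have hinj : Set.InjOn F (whites a) := by
    intro v hv v' hv' heq
    have h₁ := hFj v hv
    rw [heq] at h₁
    exact eq_of_joined_left_fixed (partner_involutive a) (partner_involutive b)
      (White.partner_eq hv) (White.partner_eq hv') (White.partner_eq (hF v' hv')) h₁ (hFj v' hv')
  have himg : F '' whites a = whites b := by
    refine Set.eq_of_subset_of_ncard_le (Set.image_subset_iff.2 hF) ?_ (Set.toFinite _)
    rw [Set.InjOn.ncard_image hinj]
    exact hcard
  intro w hw
  rw [← himg] at hw
  obtain ⟨v, hv, rfl⟩ := hw
  exact ⟨v, hv, hFj v hv⟩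

theorem gram_symm {K : Type*} [Field K] (x : K) {r : ℤ} (p q : Path k r) :
    gram x k r p q = gram x k r q p := by
  rw [gram_eq_pairing, gram_eq_pairing, pairing, pairing, loopSet_comm]
  have key : ∀ p q : Path k r,
      (∀ v ∈ whites p.1, ∃ w ∈ whites q.1, Joined (partner p.1) (partner q.1) v w) →
      ∀ v ∈ whites q.1, ∃ w ∈ whites p.1, Joined (partner q.1) (partner p.1) v w := by
    intro p q h w hw
    obtain ⟨v, hv, hj⟩ := joined_whites_surj (ncard_whites_eq q p).le h w hw
    exact ⟨v, hv, joined_comm.1 hj.symm⟩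
  by_cases h : ∀ v ∈ whites p.1, ∃ w ∈ whites q.1, Joined (partner p.1) (partner q.1) v w
  · rw [if_pos h, if_pos (key p q h)]
  · rw [if_neg h, if_neg fun h' => h (key q p h')]

end Gram

/-! ### The Gram entries of the modified basis -/

theorem cellForm_single {K : Type*} [Field K] (x : K) {k : ℕ} {r : ℤ} (p q : Path k r) :
    cellForm x k r (Finsupp.single p 1) (Finsupp.single q 1) = gram x k r p q := by
  have h := congrFun (congrFun (LinearMap.BilinForm.toMatrix_toBilin
    (Finsupp.basisSingleOne (R := K) (ι := Path k r)) (gram x k r)) p) q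
  rw [LinearMap.BilinForm.toMatrix_apply] at h
  simpa [cellForm] using h

/-- The whites of `a` in increasing order are `w 0, …, w N`. -/
structure Enumerates {k : ℕ} (a : Steps k) (w : ℕ → Fin k) (N : ℕ) : Prop where
  mono : ∀ s t, s < t → t ≤ N → w s < w t
  image : w '' Set.Iic N = whites a

theorem exists_enumerates {k : ℕ} {a : Steps k} {N : ℕ} (h : (whites a).ncard = N + 1) :
    ∃ w, Enumerates a w N := by
  classical
  rw [Set.ncard_eq_toFinset_card'] at h
  have hpos : 0 < N + 1 := N.succ_pos
  let e := (whites a).toFinset.orderEmbOfFin h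
  -- Beyond `N` the value is arbitrary; `N + 1 > 0` provides one.
  refine ⟨fun n => if hn : n < N + 1 then e ⟨n, hn⟩ else e ⟨0, hpos⟩, ?_, ?_⟩
  · intro s t hst ht
    rw [dif_pos (by omega), dif_pos (by omega)]
    exact e.strictMono hst
  · have hr := Finset.range_orderEmbOfFin (whites a).toFinset h
    rw [Set.coe_toFinset] at hr
    rw [← hr]
    ext v
    constructor
    · rintro ⟨n, hn, rfl⟩
      have hn' : n < N + 1 := Nat.lt_succ_of_le hn
      exact ⟨⟨n, hn'⟩, by simp only [hn', dif_pos]; rfl⟩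
    · rintro ⟨n, rfl⟩
      exact ⟨n, Nat.le_of_lt_succ n.2, by simp only [n.2, dif_pos]; rfl⟩

namespace Enumerates

variable {k : ℕ} {a : Steps k} {w : ℕ → Fin k} {N : ℕ} (hw : Enumerates a w N)

include hw

theorem white {s : ℕ} (hs : s ≤ N) : White a (w s) :=
  show w s ∈ whites a from hw.image ▸ ⟨s, hs, rfl⟩

theorem exists_eq {l : Fin k} (hl : White a l) : ∃ s ≤ N, w s = l := by
  have : l ∈ w '' Set.Iic N := by rw [hw.image]; exact hl
  obtain ⟨s, hs, h⟩ := this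
  exact ⟨s, hs, h⟩

theorem lt_iff {s t : ℕ} (hs : s ≤ N) (ht : t ≤ N) : w s < w t ↔ s < t := by
  refine ⟨fun h => ?_, fun h => hw.mono s t h ht⟩
  rcases lt_trichotomy s t with h' | rfl | h'
  · exact h'
  · exact absurd h (lt_irrefl _)
  · exact absurd h (hw.mono t s h' hs).not_gt

theorem consecutive {s : ℕ} (hs : s + 1 ≤ N) (l : Fin k) (h₁ : w s < l) (h₂ : l < w (s + 1)) :
    ¬ White a l := by
  intro hl
  obtain ⟨t, ht, rfl⟩ := hw.exists_eq hl
  rw [hw.lt_iff (by omega) ht] at h₁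
  rw [hw.lt_iff ht hs] at h₂
  omega

theorem marked {b : Steps k} : Marked (partner a) (partner b) (whites b) w N where
  left_inv := partner_involutive a
  right_inv := partner_involutive b
  left_nc := noncrossing_partner a
  right_nc := noncrossing_partner b
  mono := hw.mono
  left_exposed _ hs := (hw.white hs).exposed
  right_exposed _ hz := White.exposed hz

end Enumerates

/-! ### Opening the pivot edge -/

namespace PivotPath

variable {k : ℕ} {r : ℤ}

/-- The sequence of steps in which both ends of the pivot edge are made white. -/
def opened (P : PivotPath k r) : Steps k := P.replace 1 1

theorem replace_left (P : PivotPath k r) (σ τ : SignType) : P.replace σ τ P.left = σ := by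
  simp [replace, P.lt.ne]

theorem replace_right (P : PivotPath k r) (σ τ : SignType) : P.replace σ τ P.right = τ := by
  simp [replace]

theorem replace_of_ne (P : PivotPath k r) (σ τ : SignType) {l : Fin k} (h₁ : l ≠ P.left)
    (h₂ : l ≠ P.right) : P.replace σ τ l = P.path.1 l := by
  simp [replace, h₁, h₂]

theorem isPath_opened (P : PivotPath k r) : IsPath (r + 2) P.opened := by
  constructor
  · intro s
    have := P.path.2.1 s
    rw [opened, sum_replace]
    split_ifs <;> simp <;> omega
  · rw [opened, sum_replace, P.path.2.2]
    simp

/-- The pivot edge of `P` joins the whites `w s` and `w (s + 1)` of `a`. -/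
structure At (P : PivotPath k r) (a : Steps k) (w : ℕ → Fin k) (s : ℕ) : Prop where
  opened_eq : P.opened = a
  left_eq : P.left = w s
  right_eq : P.right = w (s + 1)

variable {P : PivotPath k r} {a : Steps k} {w : ℕ → Fin k} {N s : ℕ}
  (hw : Enumerates a w N) (h : P.At a w s) (hs : s + 1 ≤ N)

include h in
theorem At.apply_of_ne {σ τ : SignType} (l : Fin k) (h₁ : l ≠ w s) (h₂ : l ≠ w (s + 1)) :
    P.replace σ τ l = a l := by
  rw [← h.left_eq] at h₁
  rw [← h.right_eq] at h₂
  rw [← h.opened_eq, opened, P.replace_of_ne _ _ h₁ h₂, P.replace_of_ne _ _ h₁ h₂]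

theorem path_eq_replace (P : PivotPath k r) : P.path.1 = P.replace 1 (-1) := by
  funext l
  by_cases h₁ : l = P.left
  · rw [h₁, replace_left, P.left_eq]
  by_cases h₂ : l = P.right
  · rw [h₂, replace_right, P.right_eq]
  rw [P.replace_of_ne _ _ h₁ h₂]

include h in
theorem At.nonneg : ∀ s, 0 ≤ ∑ i ∈ Finset.Iic s, (a i : ℤ) := by
  rw [← h.opened_eq]
  exact P.isPath_opened.1

/-- All the p^(t) are thus cups on one common sequence: the entries at the old ends and at the new
left end are all 1 after opening. -/
theorem opened_shift (P : PivotPath k r) (j : Fin k) (hj : P.IsNextWhite j) :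
    (P.shift j hj).opened = P.opened := by
  funext l
  have hjl : j ≠ P.left := hj.1.ne
  have hjr : j ≠ P.right := (hj.1.trans P.lt).ne
  by_cases h₁ : l = P.left
  · rw [h₁]
    exact ((P.shift j hj).replace_right 1 1).trans (P.replace_left 1 1).symm
  by_cases h₂ : l = j
  · rw [h₂, opened, opened, P.replace_of_ne _ _ hjl hjr, hj.2.1.1]
    exact (P.shift j hj).replace_left 1 1
  rw [opened, opened, (P.shift j hj).replace_of_ne _ _ h₂ h₁]
  change P.replace (-1) 1 l = _
  by_cases h₃ : l = P.right
  · rw [h₃, replace_right, replace_right]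
  · rw [P.replace_of_ne _ _ h₁ h₃, P.replace_of_ne _ _ h₁ h₃]

include hw h hs

theorem At.partner_path : partner P.path.1 = link (partner a) (w s) (w (s + 1)) := by
  rw [path_eq_replace]
  refine partner_of_cup h.nonneg (hw.mono s (s + 1) (by omega) hs)
    (hw.white (by omega)) (hw.white hs) h.apply_of_ne (hw.consecutive hs) ?_ ?_
  · rw [← h.left_eq, replace_left]
  · rw [← h.right_eq, replace_right]

theorem At.white_path {l : Fin k} :
    White P.path.1 l ↔ White a l ∧ l ≠ w s ∧ l ≠ w (s + 1) := by
  rw [path_eq_replace]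
  refine white_of_cup h.nonneg (hw.mono s (s + 1) (by omega) hs)
    (hw.white (by omega)) (hw.white hs) h.apply_of_ne (hw.consecutive hs) ?_ ?_
  · rw [← h.left_eq, replace_left]
  · rw [← h.right_eq, replace_right]

theorem At.partner_bullet : partner P.bullet.1 = partner a := by
  refine partner_of_zero h.nonneg
    (hw.white (by omega)) (hw.white hs) h.apply_of_ne ?_ ?_
  · rw [← h.left_eq]; exact P.replace_left 0 0
  · rw [← h.right_eq]; exact P.replace_right 0 0

theorem At.white_bullet {l : Fin k} :
    White P.bullet.1 l ↔ White a l ∧ l ≠ w s ∧ l ≠ w (s + 1) := by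
  refine white_of_zero h.nonneg
    (hw.white (by omega)) (hw.white hs) h.apply_of_ne ?_ ?_
  · rw [← h.left_eq]; exact P.replace_left 0 0
  · rw [← h.right_eq]; exact P.replace_right 0 0

theorem At.whites_path : whites P.path.1 = (w '' Set.Iic N) \ {w s, w (s + 1)} := by
  rw [hw.image]
  ext l
  simp [whites, At.white_path hw h hs]

theorem At.whites_bullet : whites P.bullet.1 = (w '' Set.Iic N) \ {w s, w (s + 1)} := by
  rw [hw.image]
  ext l
  simp [whites, At.white_bullet hw h hs]

omit h hs in
-- The white vertices of `P` are the `w c` away from the pivot edge, so the rightmost one to the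
-- left of `w (s + 1)` is `w s`. In particular the value `none` does not occur here.
theorem At.next (h : P.At a w (s + 1)) (hs : s + 1 + 1 ≤ N) :
    ∃ Q, P.next = some Q ∧ Q.At a w s := by
  have hnext : P.IsNextWhite (w s) := by
    refine ⟨?_, (At.white_path hw h hs).2 ⟨hw.white (by omega), ?_, ?_⟩, ?_⟩
    · rw [h.left_eq]; exact hw.mono _ _ (by omega) (by omega)
    · exact (hw.mono _ _ (by omega) (by omega)).ne
    · exact (hw.mono _ _ (by omega) (by omega)).ne
    · intro l h₁ h₂ hl
      rw [h.left_eq] at h₂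
      exact hw.consecutive (by omega) l h₁ h₂ ((At.white_path hw h hs).1 hl).1
  have hex : ∃ j, P.IsNextWhite j := ⟨_, hnext⟩
  have huniq : ∀ j, P.IsNextWhite j → j = w s := by
    intro j hj
    rcases lt_trichotomy j (w s) with hlt | heq | hlt
    · exact absurd hnext.2.1 (hj.2.2 _ hlt hnext.1)
    · exact heq
    · exact absurd hj.2.1 (hnext.2.2 _ hlt hj.1)
  exact ⟨_, dif_pos hex, (P.opened_shift _ hex.choose_spec).trans h.opened_eq,
    huniq _ hex.choose_spec, h.left_eq⟩

end PivotPath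

open Classical in
/-- The value of the form at `[P]` and a path `q`, where the whites of `P` with its pivot edge
opened are `w 0, …, w (r + 1)`, and the pivot edge joins the last two of them. -/
theorem cellForm_bracket {K : Type*} [Field K] (x : K) {k r : ℕ}
    (hu : ∀ j : ℕ, 1 ≤ j → j ≤ r → u (j : ℤ) (x - 1) ≠ 0) {a : Steps k} {w : ℕ → Fin k}
    (hw : Enumerates a w (r + 1)) (q : Path k (r : ℤ)) (P : PivotPath k (r : ℤ))
    (hP : P.At a w r) :
    cellForm x k r (bracket x r P) (Finsupp.single q 1) =
      if CupAt (partner a) (partner q.1) (whites q.1) w (r + 1) r then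
        x ^ (loopSet (partner a) (partner q.1)).ncard *
          (u ((r : ℤ) + 1) (x - 1) / u (r : ℤ) (x - 1)) else 0 := by
  let W : ℕ → Set (Fin k) := fun s => (w '' Set.Iic (r + 1)) \ {w s, w (s + 1)}
  let F : ℕ → K := fun s =>
    pairing x (link (partner a) (w s) (w (s + 1))) (partner q.1) (W s) (whites q.1)
      - pairing x (partner a) (partner q.1) (W s) (whites q.1)
  -- `G` is the recursion of `bracket` on values. Each shift lowers both the counter of `bracket`
  -- and the position of the cup by one, so both are `s`.
  let G : ℕ → K := fun s => Nat.rec (F 0)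
    (fun s g => F (s + 1) - u (s : ℤ) (x - 1) / u ((s : ℤ) + 1) (x - 1) * g) s
  have hfirst : ∀ s ≤ r, ∀ P : PivotPath k (r : ℤ), P.At a w s →
      cellForm x k r (Finsupp.single P.path 1 - Finsupp.single P.bullet 1)
        (Finsupp.single q 1) = F s := by
    intro s hs P hP
    rw [map_sub, LinearMap.sub_apply, cellForm_single, cellForm_single, gram_eq_pairing,
      gram_eq_pairing, PivotPath.At.partner_path hw hP (by omega),
      PivotPath.At.partner_bullet hw hP (by omega), PivotPath.At.whites_path hw hP (by omega),
      PivotPath.At.whites_bullet hw hP (by omega)]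
  have hG : ∀ s ≤ r, ∀ P : PivotPath k (r : ℤ), P.At a w s →
      cellForm x k r (bracket x s P) (Finsupp.single q 1) = G s := by
    intro s
    induction s with
    | zero => exact fun hs P hP => hfirst 0 hs P hP
    | succ s ih =>
      intro hs P hP
      obtain ⟨Q, hQ, hQ'⟩ := PivotPath.At.next hw hP (by omega)
      rw [bracket, hQ, map_sub, LinearMap.sub_apply, hfirst (s + 1) hs P hP, map_smul,
        LinearMap.smul_apply, smul_eq_mul, ih (by omega) Q hQ']
  rw [hG r le_rfl P hP]
  have hm := hw.marked (b := q.1)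
  refine bracket_recursion (F := F) (G := G) hu
    (L := fun m => CupAt (partner a) (partner q.1) (whites q.1) w (r + 1) m)
    (fun m m' h₁ h₂ h₃ h₄ => hm.cupAt_unique (by omega) h₃ h₄) (fun s hs => ?_) rfl
    fun s _ => rfl
  simp only [F, W]
  rw [hm.pairing_link_sub x (by omega)]
  simp only [show s + 2 ≤ r + 1 ↔ s + 1 ≤ r by omega]

/-! ### The bracket of a path that ends in `-1` -/

section Initial

variable {n r : ℕ}

theorem paired_initialPivot (p : Path (n + 1) r) (h : p.1 (Fin.last n) = -1) :
    Paired p.1 (initialPivot p h).left (Fin.last n) :=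
  (exists_paired_last p h).choose_spec

theorem opened_initialPivot_last (p : Path (n + 1) r) (h : p.1 (Fin.last n) = -1) :
    (initialPivot p h).opened (Fin.last n) = 1 :=
  (initialPivot p h).replace_right 1 1

theorem opened_initialPivot_of_ne (p : Path (n + 1) r) (h : p.1 (Fin.last n) = -1)
    {l : Fin (n + 1)} (hl : l ≠ Fin.last n) : (initialPivot p h).opened l = p.1 l := by
  by_cases h₁ : l = (initialPivot p h).left
  · rw [h₁]
    exact ((initialPivot p h).replace_left 1 1).trans (initialPivot p h).left_eq.symm
  · exact (initialPivot p h).replace_of_ne 1 1 h₁ hl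

theorem ncard_whites_opened (p : Path (n + 1) r) (h : p.1 (Fin.last n) = -1) :
    (whites (initialPivot p h).opened).ncard = r + 2 := by
  have := ncard_whites (initialPivot p h).isPath_opened
  omega

/-- Nothing lies to the right of the last vertex and no white vertex lies below the pivot edge, so
its opened ends are the last two white vertices. -/
theorem initialPivot_at (p : Path (n + 1) r) (h : p.1 (Fin.last n) = -1)
    {w : ℕ → Fin (n + 1)} (hw : Enumerates (initialPivot p h).opened w (r + 1)) :
    (initialPivot p h).At (initialPivot p h).opened w r := by
  have hp := paired_initialPivot p h
  have hlast : White (initialPivot p h).opened (Fin.last n) :=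
    ⟨opened_initialPivot_last p h, fun j hj => absurd hj.1 (Fin.le_last j).not_gt⟩
  have hoff : ∀ {u v : Fin (n + 1)}, v < Fin.last n →
      ∑ l ∈ Finset.Icc u v, ((initialPivot p h).opened l : ℤ)
        = ∑ l ∈ Finset.Icc u v, (p.1 l : ℤ) := fun hv =>
    Finset.sum_congr rfl fun l hl => by
      rw [opened_initialPivot_of_ne p h ((Finset.mem_Icc.1 hl).2.trans_lt hv).ne]
  -- A partner of the left end would precede the last vertex, where the sums agree with those of `p`
  -- and are positive.
  have hleft : White (initialPivot p h).opened (initialPivot p h).left := by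
    refine ⟨(initialPivot p h).replace_left 1 1, fun v hv => ?_⟩
    have hvl : v < Fin.last n := by
      refine lt_of_le_of_ne (Fin.le_last v) ?_
      rintro rfl
      have := hv.right_eq
      rw [opened_initialPivot_last] at this
      exact absurd this (by decide)
    have := hv.2.2.1
    rw [hoff hvl] at this
    exact absurd this (hp.sum_pos hv.1.le hvl).ne'
  have hcons : ∀ l, (initialPivot p h).left < l → l < Fin.last n →
      ¬ White (initialPivot p h).opened l := by
    intro l h₁ h₂ hl
    have hlp : p.1 l = 1 := by rw [← opened_initialPivot_of_ne p h h₂.ne, hl.1]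
    have : White p.1 l := by
      refine ⟨hlp, fun v hv => hl.2 v ?_⟩
      have hvl := hp.lt_of_lt hv h₁ h₂
      refine ⟨hv.1, hl.1, by rw [hoff hvl, hv.2.2.1], fun m h₃ h₄ => ?_⟩
      rw [hoff (h₄.trans hvl)]
      exact hv.2.2.2 m h₃ h₄
    exact this.not_between hp h₁.le h₂.le
  have hright : w (r + 1) = Fin.last n := by
    obtain ⟨t, ht, htw⟩ := hw.exists_eq hlast
    rcases ht.eq_or_lt with rfl | hlt
    · exact htw
    · have := hw.mono t _ hlt le_rfl
      rw [htw] at this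
      exact absurd this (Fin.le_last _).not_gt
  refine ⟨rfl, ?_, hright.symm⟩
  obtain ⟨t, ht, htw⟩ := hw.exists_eq hleft
  have htr : t < r + 1 := by
    rw [← hw.lt_iff ht le_rfl, htw, hright]
    exact hp.1
  rcases (Nat.le_of_lt_succ htr).eq_or_lt with rfl | hlt
  · exact htw.symm
  · have h₁ := hw.mono t r hlt (by omega)
    have h₂ := hw.mono r (r + 1) (by omega) le_rfl
    rw [htw] at h₁
    rw [hright] at h₂
    exact absurd (hw.white (by omega)) (hcons _ h₁ h₂)

end Initial

/-! ### Unitriangularity -/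

section Triangular

variable {K : Type*} [Field K] (x : K) {n : ℕ} {r : ℤ}

variable (K n r) in
/-- The span of the paths that do not end in `-1`. -/
def unclosed : Submodule K (CellModule K (n + 1) r) :=
  Finsupp.supported K K {q | q.1 (Fin.last n) ≠ -1}

variable {x}

theorem single_mem_unclosed {q : Path (n + 1) r} (h : q.1 (Fin.last n) ≠ -1) :
    Finsupp.single q 1 ∈ unclosed K n r :=
  Finsupp.single_mem_supported K 1 h

theorem next_spec {k : ℕ} {P Q : PivotPath k r} (h : P.next = some Q) :
    Q.right = P.left ∧ Q.path.1 = P.replace (-1) 1 := by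
  unfold PivotPath.next at h
  split_ifs at h
  obtain rfl := Option.some.inj h
  exact ⟨rfl, rfl⟩

/-- The pivot edge only moves to the left, so once it has left the last vertex the entry 1 there
never changes. -/
theorem bracket_mem_unclosed (s : ℕ) (P : PivotPath (n + 1) r) (h₁ : P.path.1 (Fin.last n) = 1)
    (h₂ : Fin.last n ≠ P.right) : bracket x s P ∈ unclosed K n r := by
  have hleft : ∀ P : PivotPath (n + 1) r, Fin.last n ≠ P.left := fun P =>
    (P.lt.trans_le (Fin.le_last _)).ne'
  have hfirst : ∀ P : PivotPath (n + 1) r, P.path.1 (Fin.last n) = 1 → Fin.last n ≠ P.right →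
      Finsupp.single P.path 1 - Finsupp.single P.bullet 1 ∈ unclosed K n r := by
    intro P h₁ h₂
    refine Submodule.sub_mem _ (single_mem_unclosed ?_) (single_mem_unclosed ?_)
    · rw [h₁]; decide
    · change P.replace 0 0 _ ≠ _
      rw [P.replace_of_ne _ _ (hleft P) h₂, h₁]
      decide
  induction s generalizing P with
  | zero => exact hfirst P h₁ h₂
  | succ s ih =>
    rw [bracket]
    refine Submodule.sub_mem _ (hfirst P h₁ h₂) (Submodule.smul_mem _ _ ?_)
    cases hQ : P.next with
    | none => exact Submodule.zero_mem _
    | some Q =>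
      obtain ⟨h₃, h₄⟩ := next_spec hQ
      refine ih Q ?_ ?_
      · rw [h₄, P.replace_of_ne _ _ (hleft P) h₂, h₁]
      · rw [h₃]; exact hleft P

/-- The bullet ends in 0, and the first shift makes the last vertex white, so all further terms end
in 1. -/
theorem bracket_sub_single_mem_unclosed (s : ℕ) (P : PivotPath (n + 1) r)
    (h : P.right = Fin.last n) :
    bracket x s P - Finsupp.single P.path 1 ∈ unclosed K n r := by
  have hb : Finsupp.single P.bullet 1 ∈ unclosed K n r := by
    refine single_mem_unclosed ?_
    change P.replace 0 0 _ ≠ _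
    rw [← h, P.replace_right]
    decide
  cases s with
  | zero =>
    rw [bracket, sub_sub_cancel_left]
    exact Submodule.neg_mem _ hb
  | succ s =>
    have key : ∀ a b c : CellModule K (n + 1) r, a - b - c - a = -(b + c) := by
      intros
      abel
    rw [bracket, key]
    refine Submodule.neg_mem _ (Submodule.add_mem _ hb (Submodule.smul_mem _ _ ?_))
    cases hQ : P.next with
    | none => exact Submodule.zero_mem _
    | some Q =>
      obtain ⟨h₃, h₄⟩ := next_spec hQ
      refine bracket_mem_unclosed s Q ?_ ?_
      · rw [h₄, ← h, P.replace_right]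
      · rw [h₃, ← h]; exact P.lt.ne'

theorem modified_sub_single_mem_unclosed {r : ℕ} (p : Path (n + 1) r) :
    modified x p - Finsupp.single p 1 ∈ unclosed K n r := by
  unfold modified
  split_ifs with h
  · exact bracket_sub_single_mem_unclosed r (initialPivot p h) rfl
  · rw [sub_self]
    exact Submodule.zero_mem _

theorem modified_of_ne {r : ℕ} {p : Path (n + 1) r} (h : p.1 (Fin.last n) ≠ -1) :
    modified x p = Finsupp.single p 1 := dif_neg h

variable (x) in
/-- The linear map that sends a path to the member of the modified basis. -/
noncomputable def modifiedMap (n r : ℕ) :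
    CellModule K (n + 1) (r : ℤ) →ₗ[K] CellModule K (n + 1) (r : ℤ) :=
  Finsupp.linearCombination K (modified x)

theorem modifiedMap_eq_self {r : ℕ} {v : CellModule K (n + 1) (r : ℤ)}
    (hv : v ∈ unclosed K n r) : modifiedMap x n r v = v := by
  have : v ∈ Submodule.span K ((fun q => Finsupp.single q (1 : K)) ''
      {q : Path (n + 1) (r : ℤ) | q.1 (Fin.last n) ≠ -1}) := by
    rwa [← Finsupp.supported_eq_span_single]
  refine LinearMap.eqOn_span (f := modifiedMap x n r) (g := LinearMap.id) ?_ this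
  rintro _ ⟨q, hq, rfl⟩
  simp only [modifiedMap, Finsupp.linearCombination_single, one_smul, LinearMap.id_apply]
  exact modified_of_ne hq

theorem modifiedMap_sub_mem {r : ℕ} (v : CellModule K (n + 1) (r : ℤ)) :
    modifiedMap x n r v - v ∈ unclosed K n r := by
  induction v using Finsupp.induction_linear with
  | zero => simp
  | add v w hv hw =>
    rw [map_add, add_sub_add_comm]
    exact Submodule.add_mem _ hv hw
  | single p c =>
    have : Finsupp.single p c = c • Finsupp.single p (1 : K) := by simp
    rw [this, map_smul, ← smul_sub]
    refine Submodule.smul_mem _ _ ?_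
    simp only [modifiedMap, Finsupp.linearCombination_single, one_smul]
    exact modified_sub_single_mem_unclosed p

/-- With T = `modifiedMap`, the map T - 1 takes values in `unclosed`, on which T is the identity.
Hence (T - 1)² = 0, and 2 - T is the inverse of T. -/
theorem modifiedMap_modifiedMap {r : ℕ} (v : CellModule K (n + 1) (r : ℤ)) :
    modifiedMap x n r (modifiedMap x n r v) = modifiedMap x n r v + modifiedMap x n r v - v := by
  have h := modifiedMap_eq_self (x := x) (modifiedMap_sub_mem (x := x) v)
  rw [map_sub, sub_eq_iff_eq_add] at h
  rw [h]
  abel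

variable (x) in
/-- The modified basis. -/
noncomputable def modifiedBasis (n r : ℕ) :
    Module.Basis (Path (n + 1) (r : ℤ)) K (CellModule K (n + 1) (r : ℤ)) :=
  Finsupp.basisSingleOne.map (LinearEquiv.ofLinearMap (modifiedMap x n r)
    (LinearMap.id + LinearMap.id - modifiedMap x n r)
    (by
      refine LinearMap.ext fun v => ?_
      simp only [LinearMap.comp_apply, LinearMap.sub_apply, LinearMap.add_apply,
        LinearMap.id_apply, map_sub, map_add, modifiedMap_modifiedMap]
      abel)
    (by
      refine LinearMap.ext fun v => ?_
      simp only [LinearMap.comp_apply, LinearMap.sub_apply, LinearMap.add_apply,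
        LinearMap.id_apply, modifiedMap_modifiedMap]
      abel))

theorem modifiedBasis_apply {r : ℕ} (p : Path (n + 1) (r : ℤ)) :
    modifiedBasis x n r p = modified x p := by
  simp [modifiedBasis, modifiedMap]

end Triangular

/-! ### Appending a last entry -/

section Append

variable {n : ℕ}

/-- The path `p` with the entry `σ` appended. -/
def append {r' : ℤ} (σ : SignType) (r : ℤ) (hr : r' + (σ : ℤ) = r) (h0 : 0 ≤ r)
    (p : Path n r') : Path (n + 1) r :=
  ⟨Fin.snoc (α := fun _ => SignType) p.1 σ, by
    have htot : ∑ i, ((Fin.snoc (α := fun _ => SignType) p.1 σ : Steps (n + 1)) i : ℤ) = r := by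
      rw [Fin.sum_univ_castSucc]
      simp only [Fin.snoc_castSucc, Fin.snoc_last, p.2.2, hr]
    refine ⟨fun s => ?_, htot⟩
    induction s using Fin.lastCases with
    | last =>
      rw [show Finset.Iic (Fin.last n) = Finset.univ from Finset.Iic_top, htot]
      exact h0
    | cast s =>
      rw [Fin.sum_Iic_castSucc]
      simp only [Fin.snoc_castSucc]
      exact p.2.1 s⟩

theorem isAppend_append {r' : ℤ} (σ : SignType) (r : ℤ) (hr : r' + (σ : ℤ) = r) (h0 : 0 ≤ r)
    (p : Path n r') : IsAppend p σ (append σ r hr h0 p) :=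
  ⟨Fin.snoc_last (α := fun _ => SignType) _ _,
    fun i => Fin.snoc_castSucc (α := fun _ => SignType) _ _ i⟩

theorem IsAppend.unique {r r' : ℤ} {p : Path n r'} {σ : SignType} {q q' : Path (n + 1) r}
    (h : IsAppend p σ q) (h' : IsAppend p σ q') : q = q' := by
  refine Subtype.ext (funext fun i => ?_)
  induction i using Fin.lastCases with
  | last => rw [h.1, h'.1]
  | cast i => rw [h.2, h'.2]

theorem IsAppend.left_unique {r r' : ℤ} {p p' : Path n r'} {σ σ' : SignType}
    {q : Path (n + 1) r} (h : IsAppend p σ q) (h' : IsAppend p' σ' q) : p = p' :=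
  Subtype.ext (funext fun i => by rw [← h.2, h'.2])

/-- Deleting the last entry of a path. -/
theorem exists_isAppend {r r' : ℤ} (q : Path (n + 1) r)
    (hr : r' + (q.1 (Fin.last n) : ℤ) = r) :
    ∃ p : Path n r', IsAppend p (q.1 (Fin.last n)) q := by
  refine ⟨⟨fun i => q.1 i.castSucc, fun s => ?_, ?_⟩, rfl, fun i => rfl⟩
  · rw [← Fin.sum_Iic_castSucc (fun i => (q.1 i : ℤ))]
    exact q.2.1 _
  · have := q.2.2
    rw [Fin.sum_univ_castSucc] at this
    change ∑ i : Fin n, (q.1 i.castSucc : ℤ) = r'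
    omega

/-- The two shortened paths may have different ranks, so their comparison is spelled out instead of
using `PathLT`. -/
theorem pathLT_iff_of_isAppend {r r₁ r₂ : ℤ} {p : Path n r₁} {p' : Path n r₂} {σ σ' : SignType}
    {q q' : Path (n + 1) r} (h : IsAppend p σ q) (h' : IsAppend p' σ' q') :
    PathLT (n + 1) r q q' ↔
      σ' < σ ∨ σ = σ' ∧ ∃ i, p'.1 i < p.1 i ∧ ∀ j, i < j → p.1 j = p'.1 j := by
  constructor
  · rintro ⟨i, hi, hij⟩
    induction i using Fin.lastCases with
    | last => left; rwa [h.1, h'.1] at hi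
    | cast i =>
      right
      refine ⟨?_, i, ?_, fun j hj => ?_⟩
      · rw [← h.1, ← h'.1]; exact hij _ (Fin.castSucc_lt_last i)
      · rwa [h.2, h'.2] at hi
      · rw [← h.2, ← h'.2]; exact hij _ (Fin.castSucc_lt_castSucc_iff.2 hj)
  · rintro (hlt | ⟨rfl, i, hi, hij⟩)
    · refine ⟨Fin.last n, by rwa [h.1, h'.1], fun j hj => absurd hj (Fin.le_last j).not_gt⟩
    · refine ⟨i.castSucc, by rwa [h.2, h'.2], fun j hj => ?_⟩
      induction j using Fin.lastCases with
      | last => rw [h.1, h'.1]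
      | cast j => rw [h.2, h'.2]; exact hij j (Fin.castSucc_lt_castSucc_iff.1 hj)

variable (n) in
/-- Appending a last entry, on the disjoint union of the paths of the three possible ranks. -/
def appendSum (r : ℕ) : Path n ((r : ℤ) - 1) ⊕ (Path n (r : ℤ) ⊕ Path n ((r : ℤ) + 1)) →
    Path (n + 1) (r : ℤ) :=
  Sum.elim (append 1 r (by simp) (by simp))
    (Sum.elim (append 0 r (by simp) (by simp)) (append (-1) r (by simp) (by simp)))

theorem isAppend_inl (r : ℕ) (p : Path n ((r : ℤ) - 1)) :
    IsAppend p 1 (appendSum n r (Sum.inl p)) :=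
  isAppend_append 1 r (by simp) (by simp) p

theorem isAppend_inr_inl (r : ℕ) (p : Path n (r : ℤ)) :
    IsAppend p 0 (appendSum n r (Sum.inr (Sum.inl p))) :=
  isAppend_append 0 r (by simp) (by simp) p

theorem isAppend_inr_inr (r : ℕ) (p : Path n ((r : ℤ) + 1)) :
    IsAppend p (-1) (appendSum n r (Sum.inr (Sum.inr p))) :=
  isAppend_append (-1) r (by simp) (by simp) p

theorem appendSum_bijective (r : ℕ) : (appendSum n r).Bijective := by
  have h₁ := isAppend_inl (n := n) r
  have h₂ := isAppend_inr_inl (n := n) r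
  have h₃ := isAppend_inr_inr (n := n) r
  have hne : ∀ {r₁ r₂ : ℤ} {p : Path n r₁} {p' : Path n r₂} {σ σ' : SignType}
      {q q' : Path (n + 1) (r : ℤ)}, IsAppend p σ q → IsAppend p' σ' q' → q = q' → σ = σ' := by
    intro r₁ r₂ p p' σ σ' q q' h h' heq
    rw [← h.1, ← h'.1, heq]
  constructor
  · rintro (p | p | p) (q | q | q) heq
    · exact congrArg _ ((h₁ p).left_unique (heq ▸ h₁ q))
    · exact absurd (hne (h₁ p) (h₂ q) heq) (by decide)
    · exact absurd (hne (h₁ p) (h₃ q) heq) (by decide)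
    · exact absurd (hne (h₂ p) (h₁ q) heq) (by decide)
    · exact congrArg _ (congrArg _ ((h₂ p).left_unique (heq ▸ h₂ q)))
    · exact absurd (hne (h₂ p) (h₃ q) heq) (by decide)
    · exact absurd (hne (h₃ p) (h₁ q) heq) (by decide)
    · exact absurd (hne (h₃ p) (h₂ q) heq) (by decide)
    · exact congrArg _ (congrArg _ ((h₃ p).left_unique (heq ▸ h₃ q)))
  · intro q
    cases hq : q.1 (Fin.last n)
    · obtain ⟨p, hp⟩ := exists_isAppend (r' := (r : ℤ)) q (by rw [hq]; simp)
      rw [hq] at hp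
      exact ⟨Sum.inr (Sum.inl p), (h₂ p).unique hp⟩
    · obtain ⟨p, hp⟩ := exists_isAppend (r' := (r : ℤ) + 1) q (by rw [hq]; simp)
      rw [hq] at hp
      exact ⟨Sum.inr (Sum.inr p), (h₃ p).unique hp⟩
    · obtain ⟨p, hp⟩ := exists_isAppend (r' := (r : ℤ) - 1) q (by rw [hq]; simp)
      rw [hq] at hp
      exact ⟨Sum.inl p, (h₁ p).unique hp⟩

variable (n) in
/-- Appending a last entry preserves and reflects the order. -/
noncomputable def appendIso (r : ℕ) :
    Sum.Lex (PathLT n ((r : ℤ) - 1)) (Sum.Lex (PathLT n (r : ℤ)) (PathLT n ((r : ℤ) + 1))) ≃r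
      PathLT (n + 1) (r : ℤ) where
  toEquiv := Equiv.ofBijective (appendSum n r) (appendSum_bijective r)
  map_rel_iff' := by
    have h₁ := isAppend_inl (n := n) r
    have h₂ := isAppend_inr_inl (n := n) r
    have h₃ := isAppend_inr_inr (n := n) r
    have d₁ : (0 : SignType) < 1 := by decide
    have d₂ : (-1 : SignType) < 1 := by decide
    have d₃ : (-1 : SignType) < 0 := by decide
    rintro (p | p | p) (q | q | q)
    · exact (pathLT_iff_of_isAppend (h₁ p) (h₁ q)).trans (by simp [PathLT])
    · exact (pathLT_iff_of_isAppend (h₁ p) (h₂ q)).trans (by simp [d₁])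
    · exact (pathLT_iff_of_isAppend (h₁ p) (h₃ q)).trans (by simp [d₂])
    · exact (pathLT_iff_of_isAppend (h₂ p) (h₁ q)).trans (by simp [d₁.not_gt, d₁.ne])
    · exact (pathLT_iff_of_isAppend (h₂ p) (h₂ q)).trans (by simp [PathLT])
    · exact (pathLT_iff_of_isAppend (h₂ p) (h₃ q)).trans (by simp [d₃])
    · exact (pathLT_iff_of_isAppend (h₃ p) (h₁ q)).trans (by simp [d₂.not_gt, d₂.ne])
    · exact (pathLT_iff_of_isAppend (h₃ p) (h₂ q)).trans (by simp [d₃.not_gt, d₃.ne])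
    · exact (pathLT_iff_of_isAppend (h₃ p) (h₃ q)).trans (by simp [PathLT])

end Append

/-! ### Meanders with an isolated last vertex -/

section Isolated

variable {n : ℕ}

section Maps

variable {F G : Fin (n + 1) → Fin (n + 1)} {f g : Fin n → Fin n}
  (hF : F.Involutive) (hG : G.Involutive)
  (hFl : F (Fin.last n) = Fin.last n) (hGl : G (Fin.last n) = Fin.last n)

include hF hG hFl hGl in
theorem joined_last {v : Fin (n + 1)} : Joined F G (Fin.last n) v ↔ v = Fin.last n := by
  refine ⟨fun h => ?_, fun h => h ▸ Joined.refl _ _ _⟩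
  refine Joined.induction hF hG (P := fun v => v = Fin.last n) ?_ ?_ h rfl
  · rintro v rfl; exact hFl
  · rintro v rfl; exact hGl

variable (hFf : ∀ i, F i.castSucc = (f i).castSucc) (hGg : ∀ i, G i.castSucc = (g i).castSucc)

include hFf in
theorem involutive_of_castSucc (hF : F.Involutive) : f.Involutive := fun i => by
  have := hF i.castSucc
  rw [hFf, hFf] at this
  exact Fin.castSucc_injective n this

include hF hG hFf hGg in
theorem joined_castSucc {u : Fin n} {w : Fin (n + 1)} :
    Joined F G u.castSucc w ↔ ∃ v, w = v.castSucc ∧ Joined f g u v := by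
  constructor
  · intro h
    refine Joined.induction hF hG (P := fun w => ∃ v, w = v.castSucc ∧ Joined f g u v) ?_ ?_ h
      ⟨u, rfl, Joined.refl _ _ _⟩
    · rintro _ ⟨v, rfl, h⟩; exact ⟨f v, hFf v, h.step_left⟩
    · rintro _ ⟨v, rfl, h⟩; exact ⟨g v, hGg v, h.step_right⟩
  · rintro ⟨v, rfl, h⟩
    refine Joined.induction (involutive_of_castSucc hFf hF) (involutive_of_castSucc hGg hG)
      (P := fun v : Fin n => Joined F G u.castSucc v.castSucc) ?_ ?_ h (Joined.refl _ _ _)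
    · intro v hv; rw [← hFf]; exact hv.step_left
    · intro v hv; rw [← hGg]; exact hv.step_right

include hF hG hFf hGg in
theorem joined_castSucc_castSucc {u v : Fin n} :
    Joined F G u.castSucc v.castSucc ↔ Joined f g u v := by
  rw [joined_castSucc hF hG hFf hGg]
  constructor
  · rintro ⟨v', h, h'⟩
    rwa [Fin.castSucc_injective n h]
  · exact fun h => ⟨v, rfl, h⟩

include hF hG hFl hFf hGg in
-- The isolated last vertex is fixed, so it does not form a loop.
theorem ncard_loopSet_castSucc : (loopSet F G).ncard = (loopSet f g).ncard := by
  rw [← Set.ncard_image_of_injective (loopSet f g)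
    (Set.image_injective.2 (Fin.castSucc_injective n))]
  congr 1
  have hclass : ∀ u : Fin n, {w | Joined F G u.castSucc w}
      = Fin.castSucc '' {w | Joined f g u w} := by
    intro u
    ext w
    refine (joined_castSucc hF hG hFf hGg).trans ⟨?_, ?_⟩
    · rintro ⟨v, rfl, h⟩; exact ⟨v, h, rfl⟩
    · rintro ⟨v, h, rfl⟩; exact ⟨v, rfl, h⟩
  ext S
  constructor
  · rintro ⟨v, rfl, h⟩
    induction v using Fin.lastCases with
    | last => exact absurd hFl (h _ (Joined.refl _ _ _)).1
    | cast v =>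
      refine ⟨_, ⟨v, rfl, fun w hw => ?_⟩, (hclass v).symm⟩
      have := h w.castSucc ((joined_castSucc_castSucc hF hG hFf hGg).2 hw)
      rw [hFf, hGg] at this
      exact ⟨fun h' => this.1 (by rw [h']), fun h' => this.2 (by rw [h'])⟩
  · rintro ⟨_, ⟨v, rfl, h⟩, rfl⟩
    refine ⟨v.castSucc, (hclass v).symm, ?_⟩
    rintro _ ⟨w, hw, rfl⟩
    have := h w hw
    rw [hFf, hGg]
    exact ⟨fun h' => this.1 (Fin.castSucc_injective n h'),
      fun h' => this.2 (Fin.castSucc_injective n h')⟩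

end Maps

variable {a : Steps (n + 1)} {p : Steps n} (ha : ∀ i, a i.castSucc = p i)

include ha in
theorem paired_castSucc {u v : Fin n} : Paired a u.castSucc v.castSucc ↔ Paired p u v := by
  have hsum : ∀ u v : Fin n, ∑ l ∈ Finset.Icc u.castSucc v.castSucc, (a l : ℤ)
      = ∑ l ∈ Finset.Icc u v, (p l : ℤ) := by
    intro u v
    rw [Fin.sum_Icc_castSucc]
    exact Finset.sum_congr rfl fun l _ => by rw [ha]
  unfold Paired
  rw [hsum, ha, Fin.castSucc_lt_castSucc_iff]
  refine and_congr_right fun _ => and_congr_right fun _ => and_congr_right fun _ => ?_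
  constructor
  · intro h m h₁ h₂
    rw [← hsum]
    exact h _ (Fin.castSucc_lt_castSucc_iff.2 h₁) (Fin.castSucc_lt_castSucc_iff.2 h₂)
  · intro h m h₁ h₂
    induction m using Fin.lastCases with
    | last => exact absurd h₂ (Fin.le_last _).not_gt
    | cast m =>
      rw [hsum]
      exact h m (Fin.castSucc_lt_castSucc_iff.1 h₁) (Fin.castSucc_lt_castSucc_iff.1 h₂)

theorem not_paired_last_left (a : Steps (n + 1)) (v : Fin (n + 1)) :
    ¬ Paired a (Fin.last n) v := fun h => absurd h.1 (Fin.le_last v).not_gt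

variable (hl : a (Fin.last n) ≠ -1)

include hl

theorem not_paired_last_right (v : Fin (n + 1)) : ¬ Paired a v (Fin.last n) :=
  fun h => hl h.right_eq

theorem partner_last : partner a (Fin.last n) = Fin.last n :=
  partner_eq_self_iff.2 fun j => ⟨not_paired_last_left a j, not_paired_last_right hl j⟩

include ha

theorem partner_castSucc (i : Fin n) : partner a i.castSucc = (partner p i).castSucc := by
  rcases partner_cases p i with h | h | ⟨h, h'⟩
  · exact ((paired_castSucc ha).2 h).partner_left
  · exact ((paired_castSucc ha).2 h).partner_right
  · rw [h, partner_eq_self_iff]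
    intro j
    induction j using Fin.lastCases with
    | last => exact ⟨not_paired_last_right hl _, not_paired_last_left a _⟩
    | cast j =>
      rw [paired_castSucc ha, paired_castSucc ha]
      exact h' j

theorem white_castSucc {i : Fin n} : White a i.castSucc ↔ White p i := by
  unfold White
  rw [ha]
  refine and_congr_right fun _ => ⟨fun h j hj => h _ ((paired_castSucc ha).2 hj), fun h j => ?_⟩
  induction j using Fin.lastCases with
  | last => exact not_paired_last_right hl _
  | cast j => rw [paired_castSucc ha]; exact h j

omit ha hl in
theorem white_last_iff : White a (Fin.last n) ↔ a (Fin.last n) = 1 :=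
  ⟨fun h => h.1, fun h => ⟨h, fun j => not_paired_last_left a j⟩⟩

omit ha hl

/-- The last vertex is isolated in the meander. For `σ = 1` it is white on both sides and joined to
itself; for `σ = 0` it is white on neither. In both cases it affects neither the condition nor the
loops. -/
theorem gram_of_last_eq {K : Type*} [Field K] (x : K) {r r' : ℤ} {P Q : Path (n + 1) r}
    {p q : Path n r'} {σ : SignType} (hP : IsAppend p σ P) (hQ : IsAppend q σ Q) (hσ : σ ≠ -1) :
    gram x (n + 1) r P Q = gram x n r' p q := by
  have hPl := hP.1.trans_ne hσ
  have hQl := hQ.1.trans_ne hσ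
  have hjoin := fun u v => joined_castSucc_castSucc (u := u) (v := v) (partner_involutive P.1)
    (partner_involutive Q.1) (partner_castSucc hP.2 hPl) (partner_castSucc hQ.2 hQl)
  have hlast := fun v => joined_last (v := v) (partner_involutive P.1) (partner_involutive Q.1)
    (partner_last hPl) (partner_last hQl)
  have hiff : (∀ v ∈ whites P.1, ∃ w ∈ whites Q.1, Joined (partner P.1) (partner Q.1) v w) ↔
      ∀ v ∈ whites p.1, ∃ w ∈ whites q.1, Joined (partner p.1) (partner q.1) v w := by
    constructor
    · intro h v hv
      obtain ⟨w, hw, hj⟩ := h v.castSucc ((white_castSucc hP.2 hPl).2 hv)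
      induction w using Fin.lastCases with
      | last => exact absurd ((hlast _).1 hj.symm) (Fin.castSucc_lt_last v).ne
      | cast w => exact ⟨w, (white_castSucc hQ.2 hQl).1 hw, (hjoin _ _).1 hj⟩
    · intro h v hv
      induction v using Fin.lastCases with
      | last =>
        refine ⟨Fin.last n, white_last_iff.2 ?_, Joined.refl _ _ _⟩
        rw [hQ.1, ← hP.1]
        exact (show White P.1 _ from hv).1
      | cast v =>
        obtain ⟨w, hw, hj⟩ := h v ((white_castSucc hP.2 hPl).1 hv)
        exact ⟨w.castSucc, (white_castSucc hQ.2 hQl).2 hw, (hjoin _ _).2 hj⟩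
  rw [gram_eq_pairing, gram_eq_pairing, pairing, pairing,
    ncard_loopSet_castSucc (partner_involutive P.1) (partner_involutive Q.1)
      (partner_last hPl) (partner_castSucc hP.2 hPl) (partner_castSucc hQ.2 hQl)]
  by_cases h : ∀ v ∈ whites p.1, ∃ w ∈ whites q.1, Joined (partner p.1) (partner q.1) v w
  · rw [if_pos h, if_pos (hiff.2 h)]
  · rw [if_neg h, if_neg fun h' => h (hiff.1 h')]

theorem gram_of_last_one_zero {K : Type*} [Field K] (x : K) {r : ℤ} {P Q : Path (n + 1) r}
    (hP : P.1 (Fin.last n) = 1) (hQ : Q.1 (Fin.last n) = 0) : gram x (n + 1) r P Q = 0 := by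
  rw [gram_eq_pairing, pairing, if_neg]
  intro h
  obtain ⟨w, hw, hj⟩ := h (Fin.last n) (white_last_iff.2 hP)
  rw [joined_last (partner_involutive _) (partner_involutive _)
    (partner_last (by rw [hP]; decide)) (partner_last (by rw [hQ]; decide))] at hj
  subst hj
  have := white_last_iff.1 hw
  rw [hQ] at this
  exact absurd this (by decide)

end Isolated

/-! ### Block diagonality -/

section Blocks

variable {K : Type*} [Field K] {x : K} {n r : ℕ}

theorem cellForm_comm {k : ℕ} {r : ℤ} (v w : CellModule K k r) :
    cellForm x k r v w = cellForm x k r w v := by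
  have h : LinearMap.flip (cellForm x k r) = cellForm x k r :=
    LinearMap.BilinForm.ext_basis Finsupp.basisSingleOne fun i j => by
      rw [LinearMap.flip_apply, Finsupp.coe_basisSingleOne]
      rw [cellForm_single, cellForm_single, gram_symm]
  rw [← LinearMap.flip_apply, h]

theorem modified_of_eq {p : Path (n + 1) (r : ℤ)} (h : p.1 (Fin.last n) = -1) :
    modified x p = bracket x r (initialPivot p h) := dif_pos h

variable (hu : r + 2 ≤ n + 1 → ∀ j : ℕ, 1 ≤ j → j ≤ r → u (j : ℤ) (x - 1) ≠ 0)

/-- Opening the pivot edge exhibits `r + 2` white vertices among `n + 1`. Hence the nonvanishing of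
the `u_j` is available as soon as a path ending in -1 exists. -/
theorem rank_add_two_le {p : Path (n + 1) (r : ℤ)} (h : p.1 (Fin.last n) = -1) :
    r + 2 ≤ n + 1 := by
  rw [← ncard_whites_opened p h]
  have := Set.ncard_le_ncard (Set.subset_univ (whites (initialPivot p h).opened))
  simpa [Set.ncard_univ] using this

include hu

/-- A nonzero value needs an arc from `w r` to the last vertex, which is isolated when `q` does not
end in -1. -/
theorem cellForm_modified_unclosed {p : Path (n + 1) (r : ℤ)} (h : p.1 (Fin.last n) = -1)
    {v : CellModule K (n + 1) (r : ℤ)} (hv : v ∈ unclosed K n r) :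
    cellForm x (n + 1) r (modified x p) v = 0 := by
  obtain ⟨w, hw⟩ := exists_enumerates (ncard_whites_opened p h)
  have hP := initialPivot_at p h hw
  rw [modified_of_eq h]
  rw [unclosed, Finsupp.supported_eq_span_single] at hv
  refine LinearMap.eqOn_span (f := cellForm x (n + 1) r (bracket x r (initialPivot p h)))
    (g := 0) ?_ hv
  rintro _ ⟨q, hq, rfl⟩
  simp only [LinearMap.zero_apply]
  rw [cellForm_bracket x (hu (rank_add_two_le h)) hw q _ hP, if_neg]
  rintro ⟨hj, -⟩
  have hlast : w (r + 1) = Fin.last n := hP.right_eq.symm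
  rw [hlast] at hj
  have := (joined_last (partner_involutive _) (partner_involutive _)
    (partner_last (by rw [opened_initialPivot_last]; decide)) (partner_last hq)).1 hj.symm
  rw [← hlast] at this
  exact (hw.mono r (r + 1) (by omega) le_rfl).ne this

omit hu

/-! ### Opening the pivot edges of both paths -/

section Opened

variable {p q : Path (n + 1) (r : ℤ)} (hp : p.1 (Fin.last n) = -1) (hq : q.1 (Fin.last n) = -1)

theorem partner_opened_last :
    partner (initialPivot p hp).opened (Fin.last n) = Fin.last n :=
  partner_last (by rw [opened_initialPivot_last]; decide)

theorem joined_opened_last {v : Fin (n + 1)} :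
    Joined (partner (initialPivot p hp).opened) (partner (initialPivot q hq).opened)
      (Fin.last n) v ↔ v = Fin.last n :=
  joined_last (partner_involutive _) (partner_involutive _) (partner_opened_last hp)
    (partner_opened_last hq)

theorem white_left_opened :
    White (initialPivot q hq).opened (initialPivot q hq).left := by
  obtain ⟨w, hw⟩ := exists_enumerates (ncard_whites_opened q hq)
  rw [(initialPivot_at q hq hw).left_eq]
  exact hw.white (by omega)

theorem left_ne_last : (initialPivot q hq).left ≠ Fin.last n := (initialPivot q hq).lt.ne

theorem partner_eq_link_opened : partner q.1 =
    link (partner (initialPivot q hq).opened) (initialPivot q hq).left (Fin.last n) := by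
  obtain ⟨w, hw⟩ := exists_enumerates (ncard_whites_opened q hq)
  have hP := initialPivot_at q hq hw
  have h := PivotPath.At.partner_path hw hP le_rfl
  rw [← hP.left_eq, ← hP.right_eq] at h
  exact h

theorem white_iff_opened {l : Fin (n + 1)} : White q.1 l ↔
    White (initialPivot q hq).opened l ∧ l ≠ (initialPivot q hq).left ∧ l ≠ Fin.last n := by
  obtain ⟨w, hw⟩ := exists_enumerates (ncard_whites_opened q hq)
  have hP := initialPivot_at q hq hw
  have h := PivotPath.At.white_path hw hP le_rfl (l := l)
  rw [← hP.left_eq, ← hP.right_eq] at h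
  exact h

/-- Joining in the meander of `q`, in terms of the meander with the pivot edge of `q` opened. -/
theorem joined_partner_iff {v z : Fin (n + 1)} :
    Joined (partner (initialPivot p hp).opened) (partner q.1) v z ↔
      Joined (partner (initialPivot p hp).opened) (partner (initialPivot q hq).opened) v z ∨
      Joined (partner (initialPivot p hp).opened) (partner (initialPivot q hq).opened) v
        (initialPivot q hq).left ∧ z = Fin.last n ∨
      v = Fin.last n ∧ Joined (partner (initialPivot p hp).opened)
        (partner (initialPivot q hq).opened) (initialPivot q hq).left z := by
  rw [joined_comm, partner_eq_link_opened hq, joined_link (partner_involutive _)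
    (partner_involutive _) (white_left_opened hq).partner_eq (partner_opened_last hq)]
  simp only [joined_comm (f := partner (initialPivot q hq).opened)]
  rw [joined_opened_last hp hq]
  have : Joined (partner (initialPivot p hp).opened) (partner (initialPivot q hq).opened) v
      (Fin.last n) ↔ v = Fin.last n :=
    ⟨fun h => (joined_opened_last hp hq).1 h.symm, fun h => h ▸ Joined.refl _ _ _⟩
  rw [this]

/-- With both pivot edges opened the last vertex is isolated, so closing the one of `q` prolongs an
arc and creates no loop. -/
theorem loopSet_partner :
    (loopSet (partner (initialPivot p hp).opened) (partner q.1)).ncard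
      = (loopSet (partner (initialPivot p hp).opened)
          (partner (initialPivot q hq).opened)).ncard := by
  rw [loopSet_comm, partner_eq_link_opened hq, loopSet_link_of_not_joined (partner_involutive _)
    (partner_involutive _) (white_left_opened hq).partner_eq (partner_opened_last hq)
    (left_ne_last hq), loopSet_comm]
  intro h
  exact left_ne_last hq ((joined_opened_last hp hq).1 (joined_comm.1 h).symm)

/-- Closing the pivot edge of `q` prolongs the arc at its left end to the last vertex. A cup at `r`
is therefore the same as an arc from `w r` to that left end, and the last vertex is matched with
itself. -/
theorem cupAt_iff {w : ℕ → Fin (n + 1)}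
    (hw : Enumerates (initialPivot p hp).opened w (r + 1)) :
    CupAt (partner (initialPivot p hp).opened) (partner q.1) (whites q.1) w (r + 1) r ↔
      ∀ v ∈ whites (initialPivot p hp).opened, ∃ z ∈ whites (initialPivot q hq).opened,
        Joined (partner (initialPivot p hp).opened) (partner (initialPivot q hq).opened) v z := by
  have hlast : w (r + 1) = Fin.last n := (initialPivot_at p hp hw).right_eq.symm
  have hne : ∀ c ≤ r, w c ≠ Fin.last n := fun c hc => by
    rw [← hlast]
    exact (hw.mono c _ (by omega) le_rfl).ne
  have hjl := fun {v} => joined_opened_last (p := p) (q := q) (v := v) hp hq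
  have hleft := white_left_opened (q := q) hq
  have hfix : ∀ c ≤ r, partner (initialPivot p hp).opened (w c) = w c := fun c hc =>
    (hw.white (by omega)).partner_eq
  constructor
  · rintro ⟨h₁, h₂⟩ v hv
    obtain ⟨c, hc, rfl⟩ := hw.exists_eq hv
    rcases hc.eq_or_lt with rfl | hlt
    · refine ⟨Fin.last n, ⟨opened_initialPivot_last q hq, not_paired_last_left _⟩, ?_⟩
      rw [hlast]
      exact Joined.refl _ _ _
    have hc : c ≤ r := by omega
    rcases hc.eq_or_lt with rfl | hlt'
    · rw [hlast, joined_partner_iff hp hq] at h₁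
      rcases h₁ with h₁ | ⟨h₁, -⟩ | ⟨h₁, -⟩
      · exact absurd (hjl.1 h₁.symm) (hne c le_rfl)
      · exact ⟨_, hleft, h₁⟩
      · exact absurd h₁ (hne c le_rfl)
    · obtain ⟨z, hz, hj⟩ := h₂ c (by omega) (by omega) (by omega)
      have hz' := (white_iff_opened hq).1 hz
      rw [joined_partner_iff hp hq] at hj
      rcases hj with hj | ⟨-, hj⟩ | ⟨hj, -⟩
      · exact ⟨z, hz'.1, hj⟩
      · exact absurd hj hz'.2.2
      · exact absurd hj (hne c hc)
  · intro h
    have hwhite : ∀ c ≤ r, ∀ z ∈ whites (initialPivot q hq).opened,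
        Joined (partner (initialPivot p hp).opened) (partner (initialPivot q hq).opened)
          (w c) z → z ≠ (initialPivot q hq).left → z ∈ whites q.1 := by
      intro c hc z hz hj hzl
      refine (white_iff_opened hq).2 ⟨hz, hzl, ?_⟩
      rintro rfl
      exact hne c hc (hjl.1 hj.symm)
    have huniq : ∀ c ≤ r, ∀ d ≤ r, ∀ z ∈ whites (initialPivot q hq).opened,
        Joined (partner (initialPivot p hp).opened) (partner (initialPivot q hq).opened)
          (w c) z → Joined (partner (initialPivot p hp).opened)
          (partner (initialPivot q hq).opened) (w d) z → w c = w d := fun c hc d hd z hz h₁ h₂ =>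
      eq_of_joined_left_fixed (partner_involutive _) (partner_involutive _) (hfix c hc) (hfix d hd)
        (White.partner_eq hz) h₁ h₂
    obtain ⟨v, hv, hvj⟩ := joined_whites_surj
      (by rw [ncard_whites_opened, ncard_whites_opened]) h _ hleft
    obtain ⟨c, hc, rfl⟩ := hw.exists_eq hv
    have hcr : c ≤ r := by
      by_contra hcr
      obtain rfl : c = r + 1 := by omega
      rw [hlast, hjl] at hvj
      exact left_ne_last hq hvj
    -- Were `c < r`, the arc from `w c` to `w (r + 1)` would cut `w r` off from the white vertices
    -- of `q`.
    obtain rfl : c = r := by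
      by_contra hne'
      have hcl : Joined (partner (initialPivot p hp).opened) (partner q.1) (w c) (w (r + 1)) := by
        rw [hlast, joined_partner_iff hp hq]
        exact Or.inr (Or.inl ⟨hvj, rfl⟩)
      obtain ⟨z, hz, hj⟩ := h (w r) (hw.white (by omega))
      refine (hw.marked (b := q.1)).between (c := r) (by omega) (by omega) le_rfl hcl
        ⟨z, hwhite r le_rfl z hz hj ?_, (joined_partner_iff hp hq).2 (Or.inl hj)⟩
      rintro rfl
      exact (hw.mono c r (by omega) (by omega)).ne (huniq c hcr r le_rfl _ hz hvj hj)
    refine ⟨?_, fun d hd h₁ h₂ => ?_⟩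
    · rw [hlast, joined_partner_iff hp hq]
      exact Or.inr (Or.inl ⟨hvj, rfl⟩)
    · obtain ⟨z, hz, hj⟩ := h (w d) (hw.white hd)
      refine ⟨z, hwhite d (by omega) z hz hj ?_, (joined_partner_iff hp hq).2 (Or.inl hj)⟩
      rintro rfl
      exact (hw.mono d c (by omega) (by omega)).ne (huniq d (by omega) c hcr _ hz hj hvj)

end Opened

include hu

/-- Replacing [q] by `q` changes the value by nothing, as the difference is in `unclosed`. The
opened paths are `p'` and `q'` with 1 appended, so their Gram entry is the one of `p'` and `q'`. -/
theorem cellForm_modified_modified {p q : Path (n + 1) (r : ℤ)} {p' q' : Path n ((r : ℤ) + 1)}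
    (hp : IsAppend p' (-1) p) (hq : IsAppend q' (-1) q) :
    cellForm x (n + 1) r (modified x p) (modified x q) =
      u ((r : ℤ) + 1) (x - 1) / u (r : ℤ) (x - 1) * gram x n ((r : ℤ) + 1) p' q' := by
  obtain ⟨w, hw⟩ := exists_enumerates (ncard_whites_opened p hp.1)
  have hopen : ∀ {p : Path (n + 1) (r : ℤ)} {p' : Path n ((r : ℤ) + 1)} (hp : IsAppend p' (-1) p),
      IsAppend (r := (r : ℤ) + 2) p' 1
        ⟨(initialPivot p hp.1).opened, (initialPivot p hp.1).isPath_opened⟩ := by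
    intro p p' hp
    refine ⟨opened_initialPivot_last p hp.1, fun i => ?_⟩
    rw [← hp.2]
    exact opened_initialPivot_of_ne p hp.1 (Fin.castSucc_lt_last i).ne
  have hmod : modified x q = Finsupp.single q 1 + (modified x q - Finsupp.single q 1) := by abel
  rw [hmod, map_add, cellForm_modified_unclosed hu hp.1 (modified_sub_single_mem_unclosed q),
    add_zero, modified_of_eq hp.1, cellForm_bracket x (hu (rank_add_two_le hp.1)) hw q _
      (initialPivot_at p hp.1 hw),
    ← gram_of_last_eq x (hopen hp) (hopen hq) (by decide), gram_eq_pairing, pairing,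
    loopSet_partner hp.1 hq.1]
  have hiff := cupAt_iff hp.1 hq.1 hw
  by_cases h : ∀ v ∈ whites (initialPivot p hp.1).opened,
      ∃ z ∈ whites (initialPivot q hq.1).opened, Joined (partner (initialPivot p hp.1).opened)
        (partner (initialPivot q hq.1).opened) v z
  · rw [if_pos (hiff.2 h), if_pos h, mul_comm]
  · rw [if_neg fun h' => h (hiff.1 h'), if_neg h, mul_zero]

end Blocks
end Motzkin

theorem mainTheorem4 {K : Type*} [Field K] (x : K) (n r : ℕ)
    (hu : r + 2 ≤ n + 1 → ∀ j : ℕ, 1 ≤ j → j ≤ r → Motzkin.u (j : ℤ) (x - 1) ≠ 0) :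
    ∃ (b : Module.Basis (Motzkin.Path (n + 1) r) K (Motzkin.CellModule K (n + 1) r))
      (e : Sum.Lex (Motzkin.PathLT n ((r : ℤ) - 1))
          (Sum.Lex (Motzkin.PathLT n (r : ℤ)) (Motzkin.PathLT n ((r : ℤ) + 1))) ≃r
        Motzkin.PathLT (n + 1) (r : ℤ)),
      (∀ p, b p = Motzkin.modified x p) ∧
      (∀ p, Motzkin.IsAppend p 1 (e (Sum.inl p))) ∧
      (∀ p, Motzkin.IsAppend p 0 (e (Sum.inr (Sum.inl p)))) ∧
      (∀ p, Motzkin.IsAppend p (-1) (e (Sum.inr (Sum.inr p)))) ∧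
      (LinearMap.BilinForm.toMatrix b (Motzkin.cellForm x (n + 1) r)).submatrix e e =
        Matrix.fromBlocks (Motzkin.gram x n ((r : ℤ) - 1)) 0 0
          (Matrix.fromBlocks (Motzkin.gram x n r) 0 0
            ((Motzkin.u ((r : ℤ) + 1) (x - 1) / Motzkin.u (r : ℤ) (x - 1)) •
              Motzkin.gram x n ((r : ℤ) + 1))) := by
  open Motzkin in
  refine ⟨modifiedBasis x n r, appendIso n r, modifiedBasis_apply, isAppend_inl r,
    isAppend_inr_inl r, isAppend_inr_inr r, ?_⟩
  have h₁ : ∀ p, IsAppend p 1 (appendIso n r (Sum.inl p)) := isAppend_inl r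
  have h₂ : ∀ p, IsAppend p 0 (appendIso n r (Sum.inr (Sum.inl p))) := isAppend_inr_inl r
  have h₃ : ∀ p, IsAppend p (-1) (appendIso n r (Sum.inr (Sum.inr p))) := isAppend_inr_inr r
  have d₁ : (1 : SignType) ≠ -1 := by decide
  have d₂ : (0 : SignType) ≠ -1 := by decide
  have m₁ : ∀ p, modified x (appendIso n r (Sum.inl p)) = Finsupp.single _ 1 := fun p =>
    modified_of_ne ((h₁ p).1.trans_ne d₁)
  have m₂ : ∀ p, modified x (appendIso n r (Sum.inr (Sum.inl p))) = Finsupp.single _ 1 :=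
    fun p => modified_of_ne ((h₂ p).1.trans_ne d₂)
  have o₁ := fun p => single_mem_unclosed (K := K) ((h₁ p).1.trans_ne d₁)
  have o₂ := fun p => single_mem_unclosed (K := K) ((h₂ p).1.trans_ne d₂)
  -- Of the nine blocks, those with exactly one index in the third family vanish by orthogonality to
  -- `unclosed`, used through the symmetry of the form when the bracket is the second argument.
  ext (p | p | p) (q | q | q) <;>
    rw [Matrix.submatrix_apply, LinearMap.BilinForm.toMatrix_apply, modifiedBasis_apply,
      modifiedBasis_apply]
  · rw [m₁, m₁, cellForm_single]
    exact gram_of_last_eq x (h₁ p) (h₁ q) d₁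
  · rw [m₁, m₂, cellForm_single]
    exact gram_of_last_one_zero x (h₁ p).1 (h₂ q).1
  · rw [m₁, cellForm_comm]
    exact cellForm_modified_unclosed hu (h₃ q).1 (o₁ p)
  · rw [m₁, m₂, cellForm_single, gram_symm]
    exact gram_of_last_one_zero x (h₁ q).1 (h₂ p).1
  · rw [m₂, m₂, cellForm_single]
    exact gram_of_last_eq x (h₂ p) (h₂ q) d₂
  · rw [m₂, cellForm_comm]
    exact cellForm_modified_unclosed hu (h₃ q).1 (o₂ p)
  · rw [m₁]
    exact cellForm_modified_unclosed hu (h₃ p).1 (o₁ q)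
  · rw [m₂]
    exact cellForm_modified_unclosed hu (h₃ p).1 (o₂ q)
  · exact cellForm_modified_modified hu (h₃ p) (h₃ q)
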